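/- Let $M$ be a smooth ($C^\infty$, Hausdorff, second countable) manifold without boundary of finite dimension $n\ge 1$. Let $T^0M=M$ and $T^{r+1}M=T(T^rM)$, with canonical projections $\pi_r\colon T^{r+1}M\to T^rM$ and $\pi_{T^rM\to M}\colon T^rM\to M$. Zero vectors and linear operations on $T^{r+1}M$ refer to the vector bundle structure of $\pi_r$. For $r\ge 0$ let $T^{r+1}M\setminus 0=\{\xi\in T^{r+1}M : D\pi_{T^{r}M\to M}(\xi)\neq 0\}$. A *spray* on $T^rM$ is a smooth vector field $S\colon T^{r+1}M\setminus 0\to T(T^{r+1}M\setminus 0)$ with $D\pi_r\circ S=\mathrm{id}$ and $[E,S]=S$, where $E(\xi)=\partial_s((1+s)\xi)|_{s=0}$. A smooth curve $\gamma$ in $T^rM$ is a *geodesic* of $S$ if $\gamma'(t)\in T^{r+1}M\setminus 0$ for all $t$ and $\gamma''=S\circ\gamma'$; on a closed interval it is required to extend to a geodesic on an open interval. The *complete lift* of $S$ is the spray $S^c=D\kappa_{r+2}\circ\kappa_{r+3}\circ DS\circ\kappa_{r+2}$ on $T^{r+1}M$, where $\kappa_{r+2}\colon T^{r+2}M\to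 T^{r+2}M$ is the canonical involution, $(x,y,X,Y)\mapsto(x,X,y,Y)$ in the coordinates of $T^{r+2}M$ induced by coordinates $x$ of $T^{r}M$. A *Jacobi field* along a geodesic $\gamma$ of $S$ is a geodesic $J$ of $S^c$ with $\pi_r\circ J=\gamma$ (on a closed interval, again one that extends to an open interval). Say that $a,b\in T^rM$ are *joined by a vanishing Jacobi field* of $S$ if there are $L>0$, a geodesic $\gamma\colon[0,L]\to T^rM$ of $S$ with $\gamma(0)=a$, $\gamma(L)=b$, and a Jacobi field $J$ along $\gamma$ with $J(0)=0$ and $J(L)=0$ that is not identically zero on $[0,L]$. The points $a,b$ are *conjugate* for $S$ if moreover $a\neq b$. **Proposition.** Let $S$ be a spray on $T^rM$, $r\ge 0$. 1. If $a,b\in T^rM$ are conjugate for $S$, then the zero vectors of $T^{r+1}_aM$ and $T^{r+1}_bM$ are conjugate for $S^c$. 2. If $a,b\in T^rM$ are conjugate for $S$, then there are nonzero vectors $\xi\in T^{r+1}_aM$ and $\eta\in T^{r+1}_bM$ that are conjugate for $S^c$. 3. If $a,b\in T^{r+1}M$ are conjugate for $S^c$ and $\pi_r(a)\neq\pi_r(b)$,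 then $\pi_r(a),\pi_r(b)$ are conjugate for $S$. More generally, if $a,b\in T^{r+1}M$ are joined by a vanishing Jacobi field of $S^c$, then $\pi_r(a),\pi_r(b)$ are joined by a vanishing Jacobi field of $S$ (whether or not $a\ne b$ or $\pi_r(a)\neq\pi_r(b)$). In particular, there are points of $T^rM$ joined by a vanishing Jacobi field of $S$ if and only if there are points of $T^{r+1}M$ joined by a vanishing Jacobi field of $S^c$. -/

import Mathlib

open Set Bundle
open scoped Manifold ContDiff

noncomputable section

/-! ### Calculus on the tangent bundle of a smooth manifold

Mathlib represents a tangent vector at `x` by its components in the preferred chart at `x`.  The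
preferred chart of `TangentBundle I N` at a vector `v` is the one induced by the preferred chart of
`N` at the foot point of `v`, so a vector tangent to `TangentBundle I N` at `(x, y)` is a pair
`(X, Y)`, and `(x, y, X, Y)` are its canonical induced coordinates. -/

section Tangent

variable {E : Type*} [NormedAddCommGroup E] [NormedSpace ℝ E]
  {H : Type*} [TopologicalSpace H] (I : ModelWithCorners ℝ E H)
  {N : Type*} [TopologicalSpace N] [ChartedSpace H N]

/-- The tangent curve `γ'` of a curve `γ` in `N`, as a curve in the tangent bundle. -/
def velocity (γ : ℝ → N) (t : ℝ) : TangentBundle I N :=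
  ⟨γ t, mfderiv 𝓘(ℝ, ℝ) I γ t (1 : ℝ)⟩

/-- The slashed tangent bundle of `N` relative to a projection `p : N → M`: the vectors tangent to
`N` whose image under the tangent map of `p` is a nonzero vector of `M`. -/
def slashed {E₀ : Type*} [NormedAddCommGroup E₀] [NormedSpace ℝ E₀] {H₀ : Type*}
    [TopologicalSpace H₀] (I₀ : ModelWithCorners ℝ E₀ H₀) {M : Type*} [TopologicalSpace M]
    [ChartedSpace H₀ M] (p : N → M) : Set (TangentBundle I N) :=
  {ξ | (tangentMap I I₀ p ξ).2 ≠ 0}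

variable [IsManifold I ∞ N]

/-- The tangent bundle of a smooth manifold is a smooth manifold. -/
instance isManifold_tangentBundle : IsManifold I.tangent ∞ (TangentBundle I N) := by
  have : IsManifold I (∞ + 1) N := inferInstanceAs (IsManifold I ∞ N)
  exact Bundle.TotalSpace.isManifold E (TangentSpace I : N → Type _)

/-- The canonical involution of the second tangent bundle of `N`, which in induced coordinates is
`(x, y, X, Y) ↦ (x, X, y, Y)`. -/
def flip₂ (ξ : TangentBundle I.tangent (TangentBundle I N)) :
    TangentBundle I.tangent (TangentBundle I N) :=
  ⟨⟨ξ.1.1, (show E × E from ξ.2).1⟩,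
    (show E × E from (((show E from ξ.1.2), (show E × E from ξ.2).2)))⟩

/-- The Liouville vector field on the tangent bundle of `N`: the derivative at `s = 0` of
`s ↦ (1 + s) ξ`. -/
def liouville (ξ : TangentBundle I N) : TangentSpace I.tangent ξ :=
  (velocity I.tangent (fun s : ℝ => (⟨ξ.1, (1 + s) • ξ.2⟩ : TangentBundle I N)) 0).2

/-- The complete lift `Dκ ∘ κ ∘ DS ∘ κ` of a vector field `S` on (an open subset of) the tangent
bundle of `N`; it is a vector field on (an open subset of) the second tangent bundle of `N`. -/
def completeLift (S : TangentBundle I N → TangentBundle I.tangent (TangentBundle I N))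
    (ξ : TangentBundle I.tangent (TangentBundle I N)) :
    TangentBundle I.tangent.tangent (TangentBundle I.tangent (TangentBundle I N)) :=
  tangentMap I.tangent.tangent I.tangent.tangent (flip₂ I)
    (flip₂ I.tangent (tangentMap I.tangent I.tangent.tangent S (flip₂ I ξ)))

variable {E₀ : Type*} [NormedAddCommGroup E₀] [NormedSpace ℝ E₀] {H₀ : Type*}
  [TopologicalSpace H₀] (I₀ : ModelWithCorners ℝ E₀ H₀) {M : Type*} [TopologicalSpace M]
  [ChartedSpace H₀ M] (p : N → M)

/-- `S` is a spray on `N` (with `p : N → M` determining the slashed tangent bundle): a smooth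
vector field on the slashed tangent bundle with `Dπ ∘ S = id` and `[E, S] = S`, where `E` is the
Liouville vector field.  The values of `S` outside the slashed tangent bundle are irrelevant. -/
structure IsSpray (S : TangentBundle I N → TangentBundle I.tangent (TangentBundle I N)) :
    Prop where
  smooth : ContMDiffOn I.tangent I.tangent.tangent ∞ S (slashed I I₀ p)
  isField : ∀ ξ ∈ slashed I I₀ p, (S ξ).1 = ξ
  isSecondOrder : ∀ ξ ∈ slashed I I₀ p,
    tangentMap I.tangent I (fun η : TangentBundle I N => η.1) (S ξ) = ξ
  homogeneous : ∀ ξ ∈ slashed I I₀ p,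
    VectorField.mlieBracket I.tangent (liouville I) (fun η => (S η).2) ξ = (S ξ).2

/-- `γ` is a geodesic of `S` on the open set `s` of times: it is smooth and regular there, and
`γ'' = S ∘ γ'`. -/
structure IsGeodesicOn (S : TangentBundle I N → TangentBundle I.tangent (TangentBundle I N))
    (γ : ℝ → N) (s : Set ℝ) : Prop where
  smooth : ContMDiffOn 𝓘(ℝ, ℝ) I ∞ γ s
  regular : ∀ t ∈ s, velocity I γ t ∈ slashed I I₀ p
  eq : ∀ t ∈ s, velocity I.tangent (velocity I γ) t = S (velocity I γ t)

/-- `J` is a Jacobi field of `S` along `γ` on the open set `s` of times: a geodesic of the complete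
lift of `S` that projects to `γ`. -/
structure IsJacobiOn (S : TangentBundle I N → TangentBundle I.tangent (TangentBundle I N))
    (γ : ℝ → N) (J : ℝ → TangentBundle I N) (s : Set ℝ) : Prop where
  geodesic : IsGeodesicOn I.tangent I₀ (fun ξ : TangentBundle I N => p ξ.1) (completeLift I S) J s
  proj : ∀ t ∈ s, (J t).1 = γ t

/-- There is a geodesic `γ : [0, L] → N` of `S` from `a` to `b`, with `L > 0`, and a Jacobi field
along `γ` that vanishes at both ends but not identically.  Geodesics and Jacobi fields on the
closed interval `[0, L]` are those that extend to an open interval containing it. -/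
def HasVanishingJacobi
    (S : TangentBundle I N → TangentBundle I.tangent (TangentBundle I N)) (a b : N) : Prop :=
  ∃ L > 0, ∃ α < 0, ∃ β > L, ∃ (γ : ℝ → N) (J : ℝ → TangentBundle I N),
    IsGeodesicOn I I₀ p S γ (Ioo α β) ∧ γ 0 = a ∧ γ L = b ∧
    IsJacobiOn I I₀ p S γ J (Ioo α β) ∧ (J 0).2 = 0 ∧ (J L).2 = 0 ∧
    ∃ t ∈ Icc 0 L, (J t).2 ≠ 0

/-- `a` and `b` are conjugate points of `S`: they are distinct and can be joined by a geodesic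
along which some Jacobi field vanishes at both ends but not identically. -/
def AreConjugate
    (S : TangentBundle I N → TangentBundle I.tangent (TangentBundle I N)) (a b : N) : Prop :=
  a ≠ b ∧ HasVanishingJacobi I I₀ p S a b

end Tangent

/-! ### Iterated tangent bundles -/

/-- A smooth manifold together with its model. -/
structure SmoothMfd where
  {E : Type}
  [normedAddCommGroup : NormedAddCommGroup E]
  [normedSpace : NormedSpace ℝ E]
  {H : Type}
  [topH : TopologicalSpace H]
  I : ModelWithCorners ℝ E H
  carrier : Type*
  [topCarrier : TopologicalSpace carrier]
  [charted : ChartedSpace H carrier]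
  [isManifold : IsManifold I ∞ carrier]

namespace SmoothMfd

attribute [instance] normedAddCommGroup normedSpace topH topCarrier charted isManifold

/-- The `r`-th iterated tangent bundle of `X`, as a smooth manifold. -/
def iter (X : SmoothMfd) : ℕ → SmoothMfd
  | 0 => X
  | r + 1 => ⟨(X.iter r).I.tangent, TangentBundle (X.iter r).I (X.iter r).carrier⟩

variable (X : SmoothMfd)

/-- The points of the `r`-th iterated tangent bundle of `X`. -/
abbrev T (r : ℕ) : Type _ := (X.iter r).carrier

/-- The canonical projection of the `(r+1)`-st iterated tangent bundle to the `r`-th one. -/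
def pr (r : ℕ) (ξ : X.T (r + 1)) : X.T r :=
  (show TangentBundle (X.iter r).I (X.T r) from ξ).1

/-- The zero vector tangent to the `r`-th iterated tangent bundle at `a`. -/
def zero (r : ℕ) (a : X.T r) : X.T (r + 1) :=
  (⟨a, 0⟩ : TangentBundle (X.iter r).I (X.T r))

/-- The canonical projection of the `r`-th iterated tangent bundle to `X` itself. -/
def proj : (r : ℕ) → X.T r → X.carrier
  | 0 => fun x => x
  | r + 1 => fun ξ => proj r (X.pr r ξ)

/-- `S` is a spray on the `r`-th iterated tangent bundle of `X`. -/
def IsSpray (r : ℕ) (S : X.T (r + 1) → X.T (r + 2)) : Prop :=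
  _root_.IsSpray (X.iter r).I X.I (X.proj r) S

/-- The complete lift to the `(r+1)`-st iterated tangent bundle of a spray on the `r`-th one. -/
def completeLift (r : ℕ) (S : X.T (r + 1) → X.T (r + 2)) : X.T (r + 2) → X.T (r + 3) :=
  _root_.completeLift (X.iter r).I S

/-- `HasVanishingJacobi` for a spray on the `r`-th iterated tangent bundle of `X`. -/
def HasVanishingJacobi (r : ℕ) (S : X.T (r + 1) → X.T (r + 2)) (a b : X.T r) : Prop :=
  _root_.HasVanishingJacobi (X.iter r).I X.I (X.proj r) S a b

/-- `a` and `b` are conjugate points of the spray `S` on the `r`-th iterated tangent bundle. -/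
def AreConjugate (r : ℕ) (S : X.T (r + 1) → X.T (r + 2)) (a b : X.T r) : Prop :=
  _root_.AreConjugate (X.iter r).I X.I (X.proj r) S a b

/-- The smooth manifold given by an `n`-dimensional smooth structure on `M`. -/
abbrev of (n : ℕ) (M : Type*) [TopologicalSpace M] [ChartedSpace (EuclideanSpace ℝ (Fin n)) M]
    [IsManifold (𝓡 n) ∞ M] : SmoothMfd :=
  ⟨𝓡 n, M⟩

end SmoothMfd

end

/-! In a chart the geodesic equation of `S` reads x'' = F(x, x'). The computation of Dκ ∘ κ ∘ DS ∘ κ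
in the induced chart shows that a geodesic (x, y) of the complete lift satisfies this equation
together with its linearization y'' = DF(x, x')(y, y'). Applying this twice, a Jacobi field of the
complete lift has coordinates (x, y, U, V), where (x, y) is as above and U'' = DF(x, x')(U, U'), V''
= D²F(x, x')((U, U'), (y, y')) + DF(x, x')(V, V').

Upwards: if J and W are Jacobi fields along the same geodesic, then (x, J, 0, W) solves this system,
and it vanishes exactly where W does (`IsSolutionOn.comp_vertLift`). Taking J = W, a vanishing
Jacobi field, joins the zero vectors over the endpoints. Taking J = γ', which is a Jacobi field
without zeros (`IsSolutionOn.isSolutionOn_velocity`), joins nonzero vectors. Vectors over distinct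
points are distinct.

Downwards: U is always a Jacobi field of `S` (`IsSolutionOn.comp_horProj`). If U is not identically
zero on [0, L], it is the required field. Otherwise U vanishes on the whole open interval by
uniqueness for linear equations (`IsSolutionOn.eq_zero`), the second-derivative term disappears, and
V is a Jacobi field (`IsSolutionOn.comp_vertProj`), which is nonzero wherever the given field is. -/

noncomputable section

open Filter Topology

set_option linter.unusedSectionVars false

/-! ### Induced charts of the tangent bundle -/

section Charts

variable {E : Type*} [NormedAddCommGroup E] [NormedSpace ℝ E]
  {H : Type*} [TopologicalSpace H] (I : ModelWithCorners ℝ E H) [I.Boundaryless]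
  {N : Type*} [TopologicalSpace N] [ChartedSpace H N] [IsManifold I ∞ N]
  {E' : Type*} [NormedAddCommGroup E'] [NormedSpace ℝ E']
  {H' : Type*} [TopologicalSpace H'] (I' : ModelWithCorners ℝ E' H') [I'.Boundaryless]
  {N' : Type*} [TopologicalSpace N'] [ChartedSpace H' N'] [IsManifold I' ∞ N']

/-- The zero vector at a point. -/
def zeroVec (x : N) : TangentBundle I N := ⟨x, 0⟩

/-- The chart of the tangent bundle induced by the preferred chart at `x`. -/
def tanChart (x : N) : PartialEquiv (TangentBundle I N) (E × E) :=
  extChartAt I.tangent (zeroVec I x)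

variable {I}

theorem tanChart_eq (v : TangentBundle I N) : extChartAt I.tangent v = tanChart I v.1 := by
  unfold tanChart
  rw [FiberBundle.extChartAt, FiberBundle.extChartAt]
  rfl

theorem tanChart_apply (x : N) (v : TangentBundle I N) :
    tanChart I x v = (extChartAt I x v.1,
      fderiv ℝ (extChartAt I x ∘ (extChartAt I v.1).symm) (extChartAt I v.1 v.1) v.2) := by
  unfold tanChart
  rw [FiberBundle.extChartAt, ← fderivWithin_univ, ← I.range_eq_univ]
  rfl

theorem mem_tanChart_source {x : N} {v : TangentBundle I N} :
    v ∈ (tanChart I x).source ↔ v.1 ∈ (extChartAt I x).source := by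
  unfold tanChart
  rw [extChartAt_source, extChartAt_source]
  exact TangentBundle.mem_chart_source_iff _ _

theorem tanChart_target (x : N) :
    (tanChart I x).target = (extChartAt I x).target ×ˢ univ := by
  unfold tanChart
  rw [FiberBundle.extChartAt_target]
  congr 1
  refine inter_eq_left.2 fun z hz => ?_
  simpa [zeroVec] using (extChartAt I x).map_target hz

theorem tanChart_symm_fst {x : N} {w : E × E} (hw : w.1 ∈ (extChartAt I x).target) :
    ((tanChart I x).symm w).1 = (extChartAt I x).symm w.1 := by
  have hw' : w ∈ (tanChart I x).target := by rw [tanChart_target]; exact ⟨hw, mem_univ _⟩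
  have h1 := (tanChart I x).right_inv hw'
  have h2 := (tanChart I x).map_target hw'
  rw [mem_tanChart_source] at h2
  rw [tanChart_apply] at h1
  rw [← (extChartAt I x).left_inv h2, ← congrArg Prod.fst h1]

theorem contDiffAt_transition {x y : N} {z : E} (hz : z ∈ (extChartAt I x).target)
    (hy : (extChartAt I x).symm z ∈ (extChartAt I y).source) :
    ContDiffAt ℝ ∞ (extChartAt I y ∘ (extChartAt I x).symm) z := by
  have h := contDiffWithinAt_ext_coord_change (I := I) (n := ∞) y x (y := z)
    (by simpa [PartialEquiv.trans_source] using ⟨by simpa using hz, by simpa using hy⟩)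
  rwa [I.range_eq_univ, contDiffWithinAt_univ] at h

theorem tanChart_snd_eq_mfderiv {x : N} {v : TangentBundle I N}
    (hv : v.1 ∈ (extChartAt I x).source) :
    (tanChart I x v).2 = mfderiv I 𝓘(ℝ, E) (extChartAt I x) v.1 v.2 := by
  have h : MDifferentiableAt I 𝓘(ℝ, E) (extChartAt I x) v.1 :=
    mdifferentiableAt_extChartAt (by simpa using hv)
  rw [tanChart_apply, h.mfderiv, I.range_eq_univ, fderivWithin_univ]
  rfl

/-- Chain rule for ψ ∘ f = (ψ ∘ f ∘ φ⁻¹) ∘ φ near the foot point. Arbitrary charts φ and ψ are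
allowed, so that later computations can stay in one fixed chart while the point moves. -/
theorem tanChart_tangentMap {f : N → N'} {v : TangentBundle I N} {x : N} {y : N'}
    (hf : MDifferentiableAt I I' f v.1) (hx : v.1 ∈ (extChartAt I x).source)
    (hy : f v.1 ∈ (extChartAt I' y).source) :
    tanChart I' y (tangentMap I I' f v) = (extChartAt I' y (f v.1),
      fderiv ℝ (extChartAt I' y ∘ f ∘ (extChartAt I x).symm) (extChartAt I x v.1)
        (tanChart I x v).2) := by
  have hφ : MDifferentiableAt I 𝓘(ℝ, E) (extChartAt I x) v.1 :=
    mdifferentiableAt_extChartAt (by simpa using hx)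
  have hψ : MDifferentiableAt I' 𝓘(ℝ, E') (extChartAt I' y) (f v.1) :=
    mdifferentiableAt_extChartAt (by simpa using hy)
  have hφs : MDifferentiableAt 𝓘(ℝ, E) I (extChartAt I x).symm (extChartAt I x v.1) := by
    have := mdifferentiableWithinAt_extChartAt_symm (I := I) ((extChartAt I x).map_source hx)
    rwa [I.range_eq_univ, mdifferentiableWithinAt_univ] at this
  have hl := (extChartAt I x).left_inv hx
  refine Prod.ext (by rw [tanChart_apply]; rfl) ?_
  rw [tanChart_snd_eq_mfderiv (by exact hy), tanChart_snd_eq_mfderiv hx]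
  have hg : MDifferentiableAt 𝓘(ℝ, E) 𝓘(ℝ, E') (extChartAt I' y ∘ f ∘ (extChartAt I x).symm)
      (extChartAt I x v.1) := by
    refine MDifferentiableAt.comp _ (I' := I') (by rw [Function.comp_apply, hl]; exact hψ) ?_
    exact MDifferentiableAt.comp _ (I' := I) (by rw [hl]; exact hf) hφs
  have hev : (extChartAt I' y ∘ f ∘ (extChartAt I x).symm) ∘ extChartAt I x =ᶠ[𝓝 v.1]
      extChartAt I' y ∘ f := by
    filter_upwards [extChartAt_source_mem_nhds' hx] with w hw
    simp only [Function.comp_apply, (extChartAt I x).left_inv hw]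
  have h1 := hev.mfderiv_eq (I := I) (I' := 𝓘(ℝ, E'))
  rw [mfderiv_comp _ hg hφ, mfderiv_comp _ hψ hf, mfderiv_eq_fderiv] at h1
  exact (congrArg (fun L : E →L[ℝ] E' => L v.2) h1).symm

theorem tanChart_velocity {γ : ℝ → N} {t : ℝ} {x : N}
    (hγ : MDifferentiableAt 𝓘(ℝ, ℝ) I γ t) (hx : γ t ∈ (extChartAt I x).source) :
    tanChart I x (velocity I γ t) = (extChartAt I x (γ t), deriv (extChartAt I x ∘ γ) t) := by
  have hφ : MDifferentiableAt I 𝓘(ℝ, E) (extChartAt I x) (γ t) :=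
    mdifferentiableAt_extChartAt (by simpa using hx)
  refine Prod.ext (by rw [tanChart_apply]; rfl) ?_
  rw [tanChart_snd_eq_mfderiv (by exact hx)]
  have := mfderiv_comp t hφ hγ
  rw [mfderiv_eq_fderiv] at this
  rw [← fderiv_apply_one_eq_deriv, this]
  rfl

end Charts

/-! ### The second tangent bundle: canonical involution, vertical and horizontal components -/

section SecondCharts

variable {E : Type*} [NormedAddCommGroup E] [NormedSpace ℝ E]
  {H : Type*} [TopologicalSpace H] {I : ModelWithCorners ℝ E H} [I.Boundaryless]
  {N : Type*} [TopologicalSpace N] [ChartedSpace H N] [IsManifold I ∞ N]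

instance boundaryless_tangent : I.tangent.Boundaryless :=
  inferInstanceAs (I.prod 𝓘(ℝ, E)).Boundaryless

/-- Exchange of the two middle coordinates. -/
def swapMid (w : (E × E) × (E × E)) : (E × E) × (E × E) := ((w.1.1, w.2.1), (w.1.2, w.2.2))

theorem tanChart_change {x x₀ : N} {v : TangentBundle I N} (hx : v.1 ∈ (extChartAt I x).source)
    (hx₀ : v.1 ∈ (extChartAt I x₀).source) :
    tanChart I x₀ v = (extChartAt I x₀ v.1,
      fderiv ℝ (extChartAt I x₀ ∘ (extChartAt I x).symm) (extChartAt I x v.1)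
        (tanChart I x v).2) := by
  have := tanChart_tangentMap (I' := I) (f := id) (v := v) (x := x) (y := x₀) mdifferentiableAt_id hx hx₀
  rwa [tangentMap_id] at this

theorem tanChart_ext {x : N} {v w : TangentBundle I N} (hv : v.1 ∈ (extChartAt I x).source)
    (hw : w.1 ∈ (extChartAt I x).source) (h : tanChart I x v = tanChart I x w) : v = w :=
  (tanChart I x).injOn (mem_tanChart_source.2 hv) (mem_tanChart_source.2 hw) h

theorem tanChart_self (v : TangentBundle I N) : tanChart I v.1 v = (extChartAt I v.1 v.1, v.2) := by
  refine Prod.ext (by rw [tanChart_apply]) ?_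
  rw [tanChart_snd_eq_mfderiv (mem_extChartAt_source _), mfderiv_extChartAt_self]
  rfl

/-- The transition map of induced charts is (z, y) ↦ (τ z, Dτ(z) y), and differentiating the second
entry by the product rule produces the D²τ term. This term is what makes components in the second
tangent bundle depend on the chart. -/
theorem fderiv_tanChart_change {x x₀ : N} {v : TangentBundle I N}
    (hx : v.1 ∈ (extChartAt I x).source) (hx₀ : v.1 ∈ (extChartAt I x₀).source) (X Y : E) :
    fderiv ℝ (tanChart I x₀ ∘ (tanChart I x).symm) (tanChart I x v) (X, Y) =
      (fderiv ℝ (extChartAt I x₀ ∘ (extChartAt I x).symm) (extChartAt I x v.1) X,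
        fderiv ℝ (fderiv ℝ (extChartAt I x₀ ∘ (extChartAt I x).symm)) (extChartAt I x v.1) X
          (tanChart I x v).2 +
        fderiv ℝ (extChartAt I x₀ ∘ (extChartAt I x).symm) (extChartAt I x v.1) Y) := by
  set τ := extChartAt I x₀ ∘ (extChartAt I x).symm with hτ
  set z := extChartAt I x v.1 with hz
  have hzt : z ∈ (extChartAt I x).target := (extChartAt I x).map_source hx
  have hzs : (extChartAt I x).symm z = v.1 := (extChartAt I x).left_inv hx
  have hsm : ContDiffAt ℝ ∞ τ z := contDiffAt_transition hzt (by rwa [hzs])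
  have hv : tanChart I x v = (z, (tanChart I x v).2) := Prod.ext (by rw [tanChart_apply]) rfl
  have hev : tanChart I x₀ ∘ (tanChart I x).symm =ᶠ[𝓝 (tanChart I x v)]
      fun w => (τ w.1, fderiv ℝ τ w.1 w.2) := by
    have h1 : ∀ᶠ z' in 𝓝 z, z' ∈ (extChartAt I x).target := extChartAt_target_mem_nhds' hzt
    have h2 : ∀ᶠ z' in 𝓝 z, (extChartAt I x).symm z' ∈ (extChartAt I x₀).source :=
      (continuousAt_extChartAt_symm'' hzt).eventually
        (by rw [hzs]; exact extChartAt_source_mem_nhds' hx₀)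
    have h3 : Tendsto Prod.fst (𝓝 (tanChart I x v)) (𝓝 z) := by
      rw [hv]; exact continuous_fst.continuousAt
    filter_upwards [h3.eventually h1, h3.eventually h2] with w hw1 hw2
    have hwt : w ∈ (tanChart I x).target := by rw [tanChart_target]; exact ⟨hw1, mem_univ _⟩
    have hwf := tanChart_symm_fst (I := I) hw1
    have hw := (tanChart I x).right_inv hwt
    rw [Function.comp_apply, tanChart_change (x := x) (by rw [hwf]; exact (extChartAt I x).map_target hw1)
      (by rwa [hwf]), hw, hwf, (extChartAt I x).right_inv hw1]
    rfl
  rw [hev.fderiv_eq]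
  have hd : HasFDerivAt τ (fderiv ℝ τ z) z := (hsm.differentiableAt (by simp)).hasFDerivAt
  have hdd : HasFDerivAt (fderiv ℝ τ) (fderiv ℝ (fderiv ℝ τ) z) z :=
    ((hsm.fderiv_right (m := 1) (by norm_cast)).differentiableAt (by simp)).hasFDerivAt
  rw [hv]
  set y := (tanChart I x v).2
  have hf : HasFDerivAt (Prod.fst : E × E → E) (ContinuousLinearMap.fst ℝ E E) (z, y) :=
    hasFDerivAt_fst
  have hs : HasFDerivAt (Prod.snd : E × E → E) (ContinuousLinearMap.snd ℝ E E) (z, y) :=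
    hasFDerivAt_snd
  have h1 := HasFDerivAt.comp (z, y) (g := τ) (f := Prod.fst) hd hf
  have h2 := HasFDerivAt.comp (z, y) (g := fderiv ℝ τ) (f := Prod.fst) hdd hf
  have h3 := h1.prodMk (h2.clm_apply hs)
  have h4 := h3.fderiv
  refine (congrArg (fun L : E × E →L[ℝ] E × E => L (X, Y)) h4).trans ?_
  simp [add_comm]

/-- Operations such as `flip₂` are given by components in the preferred chart of the moving foot
point; this formula transports them to a fixed chart. -/
theorem tanChart₂_apply {x₀ : N} {ξ : TangentBundle I.tangent (TangentBundle I N)}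
    (hx₀ : ξ.1.1 ∈ (extChartAt I x₀).source) :
    tanChart I.tangent (zeroVec I x₀) ξ = (tanChart I x₀ ξ.1,
      (fderiv ℝ (extChartAt I x₀ ∘ (extChartAt I ξ.1.1).symm) (extChartAt I ξ.1.1 ξ.1.1)
        (show E × E from ξ.2).1,
        fderiv ℝ (fderiv ℝ (extChartAt I x₀ ∘ (extChartAt I ξ.1.1).symm))
          (extChartAt I ξ.1.1 ξ.1.1) (show E × E from ξ.2).1 ξ.1.2 +
        fderiv ℝ (extChartAt I x₀ ∘ (extChartAt I ξ.1.1).symm) (extChartAt I ξ.1.1 ξ.1.1)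
          (show E × E from ξ.2).2)) := by
  have h := fderiv_tanChart_change (I := I) (mem_extChartAt_source ξ.1.1) hx₀
    (show E × E from ξ.2).1 (show E × E from ξ.2).2
  rw [tanChart_apply, tanChart_eq ξ.1]
  refine Prod.ext rfl (h.trans ?_)
  rw [tanChart_self]

/-- The involution has the same form in every chart because the second derivative of a transition
map is symmetric. -/
theorem tanChart₂_flip₂ {x₀ : N} {ξ : TangentBundle I.tangent (TangentBundle I N)}
    (hx₀ : ξ.1.1 ∈ (extChartAt I x₀).source) :
    tanChart I.tangent (zeroVec I x₀) (flip₂ I ξ) =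
      swapMid (tanChart I.tangent (zeroVec I x₀) ξ) := by
  have hsm : ContDiffAt ℝ ∞ (extChartAt I x₀ ∘ (extChartAt I ξ.1.1).symm)
      (extChartAt I ξ.1.1 ξ.1.1) :=
    contDiffAt_transition (mem_extChartAt_target _) (by simpa using hx₀)
  have hsym := hsm.isSymmSndFDerivAt
    (by rw [minSmoothness_of_isRCLikeNormedField]; exact ENat.LEInfty.out)
  rw [tanChart₂_apply hx₀, tanChart₂_apply (ξ := flip₂ I ξ) hx₀, tanChart_apply, tanChart_apply]
  refine Prod.ext (Prod.ext rfl rfl) (Prod.ext rfl ?_)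
  exact congrArg₂ (· + ·) (hsym.eq _ _) rfl

/-- The vector tangent to the fibre at `v` with components `w`. -/
def vertLift (v w : TangentBundle I N) : TangentBundle I.tangent (TangentBundle I N) :=
  ⟨v, (show E × E from (0, w.2))⟩

/-- The second component of a vector tangent to the tangent bundle. For a vertical vector this is
its canonical projection to the tangent bundle. -/
def vertProj (ξ : TangentBundle I.tangent (TangentBundle I N)) : TangentBundle I N :=
  ⟨ξ.1.1, (show E × E from ξ.2).2⟩

theorem clm_zero_apply_add (A : E →L[ℝ] E →L[ℝ] E) (B : E →L[ℝ] E) (y Y : E) :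
    A 0 y + B Y = B Y := by
  simp

/-- The last component is independent of the chart only for vertical vectors: then the D²τ term,
being linear in the horizontal component, drops out. -/
theorem tanChart_vertProj {x₀ : N} {ξ : TangentBundle I.tangent (TangentBundle I N)}
    (hx₀ : ξ.1.1 ∈ (extChartAt I x₀).source) (hξ : (show E × E from ξ.2).1 = 0) :
    tanChart I x₀ (vertProj ξ) = ((tanChart I.tangent (zeroVec I x₀) ξ).1.1,
      (tanChart I.tangent (zeroVec I x₀) ξ).2.2) := by
  rw [tanChart₂_apply hx₀, hξ, tanChart_apply, tanChart_apply]
  exact Prod.ext rfl (clm_zero_apply_add _ _ _ _).symm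

theorem tanChart₂_vertLift {x₀ : N} {v w : TangentBundle I N}
    (hx₀ : v.1 ∈ (extChartAt I x₀).source) (hvw : w.1 = v.1) :
    tanChart I.tangent (zeroVec I x₀) (vertLift v w) =
      (tanChart I x₀ v, (0, (tanChart I x₀ w).2)) := by
  obtain ⟨x, w⟩ := w
  obtain rfl : x = v.1 := hvw
  rw [tanChart₂_apply (ξ := vertLift v ⟨v.1, w⟩) hx₀]
  refine Prod.ext rfl (Prod.ext (map_zero _) ?_)
  rw [tanChart_apply x₀ ⟨v.1, w⟩]
  exact clm_zero_apply_add (E := E)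
    (fderiv ℝ (fderiv ℝ (extChartAt I x₀ ∘ (extChartAt I v.1).symm)) (extChartAt I v.1 v.1))
    (fderiv ℝ (extChartAt I x₀ ∘ (extChartAt I v.1).symm) (extChartAt I v.1 v.1)) v.2 w

/-- The horizontal component of a vector tangent to the tangent bundle: its image under the tangent
map of the projection. -/
def horProj (ξ : TangentBundle I.tangent (TangentBundle I N)) : TangentBundle I N :=
  ⟨ξ.1.1, (show E × E from ξ.2).1⟩

theorem tanChart_horProj {x₀ : N} {ξ : TangentBundle I.tangent (TangentBundle I N)}
    (hx₀ : ξ.1.1 ∈ (extChartAt I x₀).source) :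
    tanChart I x₀ (horProj ξ) = ((tanChart I.tangent (zeroVec I x₀) ξ).1.1,
      (tanChart I.tangent (zeroVec I x₀) ξ).2.1) := by
  rw [tanChart₂_apply hx₀, tanChart_apply, tanChart_apply]
  rfl

theorem tanChart_snd_eq_zero_iff {x : N} {v : TangentBundle I N}
    (hv : v.1 ∈ (extChartAt I x).source) : (tanChart I x v).2 = 0 ↔ v.2 = 0 := by
  rw [tanChart_snd_eq_mfderiv hv]
  have h := isInvertible_mfderiv_extChartAt (I := I) hv
  obtain ⟨e, he⟩ := h
  rw [← he]
  exact e.map_eq_zero_iff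

theorem mdifferentiable_tangentBundle_proj :
    MDifferentiable I.tangent I (fun η : TangentBundle I N => η.1) :=
  (contMDiff_proj (n := 1) (TangentSpace I : N → Type _)).mdifferentiable (by simp)

/-- In induced charts the bundle projection is the linear map `Prod.fst`, hence its own derivative.
-/
theorem tangentMap_proj_eq_horProj (ξ : TangentBundle I.tangent (TangentBundle I N)) :
    tangentMap I.tangent I (fun η : TangentBundle I N => η.1) ξ = horProj ξ := by
  have hs : ξ.1.1 ∈ (extChartAt I ξ.1.1).source := mem_extChartAt_source _
  have hs' : ξ.1 ∈ (tanChart I ξ.1.1).source := mem_tanChart_source.2 hs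
  suffices h : tanChart I ξ.1.1 (tangentMap I.tangent I (fun η : TangentBundle I N => η.1) ξ) =
      tanChart I ξ.1.1 (horProj ξ) from
    tanChart_ext hs hs h
  rw [tanChart_horProj hs]
  have h := tanChart_tangentMap (I := I.tangent) (I' := I) (v := ξ) (x := zeroVec I ξ.1.1)
    (y := ξ.1.1) (mdifferentiable_tangentBundle_proj ξ.1) hs' hs
  rw [h]
  have hev : (extChartAt I ξ.1.1 ∘ (fun η : TangentBundle I N => η.1) ∘ (tanChart I ξ.1.1).symm)
      =ᶠ[𝓝 (tanChart I ξ.1.1 ξ.1)] Prod.fst := by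
    have := extChartAt_target_mem_nhds' (I := I.tangent) ((tanChart I ξ.1.1).map_source hs')
    filter_upwards [this] with w hw
    have hw' : w ∈ (tanChart I ξ.1.1).target := hw
    rw [tanChart_target] at hw'
    simp only [Function.comp_apply, tanChart_symm_fst hw'.1, (extChartAt I ξ.1.1).right_inv hw'.1]
  refine Prod.ext ?_ ?_
  · rw [tanChart_apply, tanChart_eq, tanChart_apply]; rfl
  · refine (congrArg (fun L : E × E →L[ℝ] E => L (tanChart I.tangent (zeroVec I ξ.1.1) ξ).2)
      hev.fderiv_eq).trans ?_
    rw [fderiv_fst]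
    rfl

end SecondCharts

/-! ### Second order vector fields and their complete lifts -/

section Semispray

variable {E : Type*} [NormedAddCommGroup E] [NormedSpace ℝ E]
  {H : Type*} [TopologicalSpace H] {I : ModelWithCorners ℝ E H} [I.Boundaryless]
  {N : Type*} [TopologicalSpace N] [ChartedSpace H N] [IsManifold I ∞ N]
  {E' : Type*} [NormedAddCommGroup E'] [NormedSpace ℝ E']
  {H' : Type*} [TopologicalSpace H'] {I' : ModelWithCorners ℝ E' H'} [I'.Boundaryless]
  {N' : Type*} [TopologicalSpace N'] [ChartedSpace H' N'] [IsManifold I' ∞ N']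

theorem contMDiffAt_of_chart {f : N → N'} {g : E → E'} {a x : N} {y : N'}
    (ha : a ∈ (extChartAt I x).source) (hf : ∀ᶠ b in 𝓝 a, f b ∈ (extChartAt I' y).source)
    (hg : ContDiffAt ℝ ∞ g (extChartAt I x a))
    (hfg : ∀ᶠ b in 𝓝 a, extChartAt I' y (f b) = g (extChartAt I x b)) :
    ContMDiffAt I I' ∞ f a := by
  have h1 : ContMDiffAt I 𝓘(ℝ, E) ∞ (extChartAt I x) a := contMDiffAt_extChartAt' (by simpa using ha)
  have hmem : g (extChartAt I x a) ∈ (extChartAt I' y).target := by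
    rw [← hfg.self_of_nhds]; exact (extChartAt I' y).map_source hf.self_of_nhds
  have h2 : ContMDiffAt 𝓘(ℝ, E') I' ∞ (extChartAt I' y).symm (g (extChartAt I x a)) :=
    (contMDiffOn_extChartAt_symm y).contMDiffAt (extChartAt_target_mem_nhds' hmem)
  have h3 : ContMDiffAt I I' ∞ ((extChartAt I' y).symm ∘ g ∘ extChartAt I x) a :=
    ContMDiffAt.comp a (by exact h2) (ContMDiffAt.comp a hg.contMDiffAt h1)
  refine h3.congr_of_eventuallyEq ?_
  filter_upwards [hf, hfg] with b hb hb'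
  simp only [Function.comp_apply, ← hb', (extChartAt I' y).left_inv hb]

theorem contMDiffAt_curve_of_chart {γ : ℝ → N} {t : ℝ} {x : N}
    (hf : ∀ᶠ s in 𝓝 t, γ s ∈ (extChartAt I x).source)
    (hg : ContDiffAt ℝ ∞ (extChartAt I x ∘ γ) t) : ContMDiffAt 𝓘(ℝ, ℝ) I ∞ γ t :=
  contMDiffAt_of_chart (I := 𝓘(ℝ, ℝ)) (x := t) (by simp) hf (g := extChartAt I x ∘ γ)
    (by rw [extChartAt_model_space_eq_id]; exact hg)
    (by rw [extChartAt_model_space_eq_id]; exact .of_forall fun _ => rfl)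

theorem contDiffAt_chart_comp {γ : ℝ → N} {t : ℝ} {x : N} (hγ : ContMDiffAt 𝓘(ℝ, ℝ) I ∞ γ t)
    (hx : γ t ∈ (extChartAt I x).source) : ContDiffAt ℝ ∞ (extChartAt I x ∘ γ) t :=
  (ContMDiffAt.comp t (contMDiffAt_extChartAt' (I := I) (n := ∞) (x := x) (by simpa using hx))
    hγ).contDiffAt

/-- `S` is a smooth second order vector field on the open set `D` of tangent vectors. -/
structure IsSemisprayOn (S : TangentBundle I N → TangentBundle I.tangent (TangentBundle I N))
    (D : Set (TangentBundle I N)) : Prop where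
  isOpen : IsOpen D
  smooth : ContMDiffOn I.tangent I.tangent.tangent ∞ S D
  isField : ∀ ξ ∈ D, (S ξ).1 = ξ
  isSecondOrder : ∀ ξ ∈ D, horProj (S ξ) = ξ

/-- The acceleration of the second order vector field `S` in the chart at `x`. -/
def accel (S : TangentBundle I N → TangentBundle I.tangent (TangentBundle I N)) (x : N)
    (w : E × E) : E :=
  (tanChart I.tangent (zeroVec I x) (S ((tanChart I x).symm w))).2.2

variable {S : TangentBundle I N → TangentBundle I.tangent (TangentBundle I N)}
  {D : Set (TangentBundle I N)}

/-- The two section conditions fix three of the four components, leaving only the acceleration free.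
-/
theorem IsSemisprayOn.tanChart_apply (hS : IsSemisprayOn S D) {x : N} {ξ : TangentBundle I N}
    (hξ : ξ ∈ D) (hx : ξ.1 ∈ (extChartAt I x).source) :
    tanChart I.tangent (zeroVec I x) (S ξ) =
      (tanChart I x ξ, ((tanChart I x ξ).2, accel S x (tanChart I x ξ))) := by
  have h1 := hS.isField ξ hξ
  have hx' : (S ξ).1.1 ∈ (extChartAt I x).source := by rwa [h1]
  have h2 := tanChart_horProj hx'
  rw [hS.isSecondOrder ξ hξ] at h2
  have h3 : (tanChart I.tangent (zeroVec I x) (S ξ)).1 = tanChart I x ξ := by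
    rw [tanChart₂_apply hx', h1]
  refine Prod.ext h3 (Prod.ext (congrArg Prod.snd h2).symm ?_)
  rw [accel, (tanChart I x).left_inv (mem_tanChart_source.2 hx)]

theorem eventually_mem_domain (hD : IsOpen D) {x : N} {ξ : TangentBundle I N} (hξ : ξ ∈ D)
    (hx : ξ.1 ∈ (extChartAt I x).source) :
    ∀ᶠ w in 𝓝 (tanChart I x ξ), w ∈ (tanChart I x).target ∧ (tanChart I x).symm w ∈ D := by
  have hs : ξ ∈ (tanChart I x).source := mem_tanChart_source.2 hx
  have ht := (tanChart I x).map_source hs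
  have h1 : ∀ᶠ w in 𝓝 (tanChart I x ξ), w ∈ (tanChart I x).target :=
    extChartAt_target_mem_nhds' (I := I.tangent) ht
  have h2 : ContinuousAt (tanChart I x).symm (tanChart I x ξ) :=
    continuousAt_extChartAt_symm'' (I := I.tangent) ht
  refine h1.and (h2.eventually ?_)
  rw [(tanChart I x).left_inv hs]
  exact hD.mem_nhds hξ

theorem symm_fst_mem_source {x : N} {w : E × E} (hw : w ∈ (tanChart I x).target) :
    ((tanChart I x).symm w).1 ∈ (extChartAt I x).source :=
  mem_tanChart_source.1 ((tanChart I x).map_target hw)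

theorem IsSemisprayOn.eventually_rep (hS : IsSemisprayOn S D) {x : N} {ξ : TangentBundle I N}
    (hξ : ξ ∈ D) (hx : ξ.1 ∈ (extChartAt I x).source) :
    tanChart I.tangent (zeroVec I x) ∘ S ∘ (tanChart I x).symm =ᶠ[𝓝 (tanChart I x ξ)]
      fun w => (w, (w.2, accel S x w)) := by
  filter_upwards [eventually_mem_domain hS.isOpen hξ hx] with w hw
  have := hS.tanChart_apply hw.2 (symm_fst_mem_source hw.1)
  rwa [(tanChart I x).right_inv hw.1] at this

theorem IsSemisprayOn.contMDiffAt (hS : IsSemisprayOn S D) {ξ : TangentBundle I N} (hξ : ξ ∈ D) :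
    ContMDiffAt I.tangent I.tangent.tangent ∞ S ξ :=
  hS.smooth.contMDiffAt (hS.isOpen.mem_nhds hξ)

theorem IsSemisprayOn.contDiffAt_accel (hS : IsSemisprayOn S D) {x : N} {ξ : TangentBundle I N}
    (hξ : ξ ∈ D) (hx : ξ.1 ∈ (extChartAt I x).source) :
    ContDiffAt ℝ ∞ (accel S x) (tanChart I x ξ) := by
  have hs : ξ ∈ (tanChart I x).source := mem_tanChart_source.2 hx
  have ht := (tanChart I x).map_source hs
  have hl := (tanChart I x).left_inv hs
  have h1 : ContMDiffAt 𝓘(ℝ, E × E) I.tangent ∞ (tanChart I x).symm (tanChart I x ξ) :=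
    (contMDiffOn_extChartAt_symm (I := I.tangent) (zeroVec I x)).contMDiffAt
      (extChartAt_target_mem_nhds' (I := I.tangent) ht)
  have h2 : ContMDiffAt I.tangent I.tangent.tangent ∞ S ((tanChart I x).symm (tanChart I x ξ)) := by
    rw [hl]; exact hS.contMDiffAt hξ
  have h3 : ContMDiffAt I.tangent.tangent 𝓘(ℝ, (E × E) × (E × E)) ∞
      (tanChart I.tangent (zeroVec I x)) (S ((tanChart I x).symm (tanChart I x ξ))) := by
    rw [hl]
    refine contMDiffAt_extChartAt' (I := I.tangent.tangent) ?_
    rw [← extChartAt_source (I := I.tangent.tangent)]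
    refine mem_tanChart_source.2 (mem_tanChart_source.2 ?_)
    rwa [hS.isField ξ hξ]
  have h4 := ContMDiffAt.comp (tanChart I x ξ) h3 (ContMDiffAt.comp (tanChart I x ξ) h2 h1)
  exact h4.contDiffAt.snd.snd

theorem mem_tanChart₂_source {x : N} {ξ : TangentBundle I.tangent (TangentBundle I N)} :
    ξ ∈ (tanChart I.tangent (zeroVec I x)).source ↔ ξ.1.1 ∈ (extChartAt I x).source :=
  mem_tanChart_source.trans mem_tanChart_source

theorem eventually_mem_tanChart₂_source {x : N}
    {ξ : TangentBundle I.tangent (TangentBundle I N)} (hξ : ξ.1.1 ∈ (extChartAt I x).source) :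
    ∀ᶠ η in 𝓝 ξ, η.1.1 ∈ (extChartAt I x).source := by
  have h : (tanChart I.tangent (zeroVec I x)).source ∈ 𝓝 ξ :=
    extChartAt_source_mem_nhds' (I := I.tangent.tangent) (mem_tanChart₂_source.2 hξ)
  filter_upwards [h] with η hη
  exact mem_tanChart₂_source.1 hη

theorem contMDiffAt_flip₂ (ξ : TangentBundle I.tangent (TangentBundle I N)) :
    ContMDiffAt I.tangent.tangent I.tangent.tangent ∞ (flip₂ I) ξ := by
  have hξ : ξ.1.1 ∈ (extChartAt I ξ.1.1).source := mem_extChartAt_source _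
  have hev := eventually_mem_tanChart₂_source hξ
  have hs : ∀ᶠ η in 𝓝 ξ, flip₂ I η ∈ (tanChart I.tangent (zeroVec I ξ.1.1)).source := by
    filter_upwards [hev] with η hη
    exact (mem_tanChart₂_source (ξ := flip₂ I η)).2 hη
  have he : ∀ᶠ η in 𝓝 ξ, tanChart I.tangent (zeroVec I ξ.1.1) (flip₂ I η) =
      swapMid (tanChart I.tangent (zeroVec I ξ.1.1) η) := by
    filter_upwards [hev] with η hη
    exact tanChart₂_flip₂ hη
  have hsm : ContDiff ℝ ∞ (swapMid : (E × E) × (E × E) → (E × E) × (E × E)) := by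
    unfold swapMid; fun_prop
  exact contMDiffAt_of_chart (I := I.tangent.tangent) (I' := I.tangent.tangent)
    (mem_tanChart₂_source.2 hξ) hs hsm.contDiffAt he

/-- `swapMid` as a continuous linear map. -/
def swapMidL : (E × E) × (E × E) →L[ℝ] (E × E) × (E × E) where
  toFun := swapMid
  map_add' _ _ := rfl
  map_smul' _ _ := rfl
  cont := by unfold swapMid; fun_prop

theorem tanChart_tangentMap_flip₂ {x : N}
    {ζ : TangentBundle I.tangent.tangent (TangentBundle I.tangent (TangentBundle I N))}
    (hx : ζ.1.1.1 ∈ (extChartAt I x).source) :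
    tanChart I.tangent.tangent (zeroVec I.tangent (zeroVec I x))
        (tangentMap I.tangent.tangent I.tangent.tangent (flip₂ I) ζ) =
      (swapMid (tanChart I.tangent.tangent (zeroVec I.tangent (zeroVec I x)) ζ).1,
        swapMid (tanChart I.tangent.tangent (zeroVec I.tangent (zeroVec I x)) ζ).2) := by
  have hs : ζ.1 ∈ (tanChart I.tangent (zeroVec I x)).source :=
    mem_tanChart_source.2 (mem_tanChart_source.2 hx)
  have hs' : flip₂ I ζ.1 ∈ (tanChart I.tangent (zeroVec I x)).source :=
    mem_tanChart_source.2 (mem_tanChart_source.2 hx)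
  have h := tanChart_tangentMap (I := I.tangent.tangent) (I' := I.tangent.tangent) (f := flip₂ I)
    (v := ζ) (x := zeroVec I.tangent (zeroVec I x)) (y := zeroVec I.tangent (zeroVec I x))
    ((contMDiffAt_flip₂ ζ.1).mdifferentiableAt (by simp)) hs hs'
  rw [h]
  have hev : (tanChart I.tangent (zeroVec I x) ∘ flip₂ I ∘ (tanChart I.tangent (zeroVec I x)).symm)
      =ᶠ[𝓝 (tanChart I.tangent (zeroVec I x) ζ.1)] swapMidL := by
    have := extChartAt_target_mem_nhds' (I := I.tangent.tangent)
      ((tanChart I.tangent (zeroVec I x)).map_source hs)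
    filter_upwards [this] with w hw
    have hw' : w ∈ (tanChart I.tangent (zeroVec I x)).target := hw
    rw [Function.comp_apply, Function.comp_apply,
      tanChart₂_flip₂ (mem_tanChart_source.1 (symm_fst_mem_source hw')),
      (tanChart I.tangent (zeroVec I x)).right_inv hw']
    rfl
  refine Prod.ext ?_ ?_
  · refine (tanChart₂_flip₂ (ξ := ζ.1) hx).trans ?_
    rw [_root_.tanChart_apply _ ζ]
    rfl
  · refine (congrArg (fun L : (E × E) × (E × E) →L[ℝ] (E × E) × (E × E) => L _)
      hev.fderiv_eq).trans ?_
    rw [ContinuousLinearMap.fderiv]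
    rfl

/-- With F the acceleration, (x, y, X, Y) is carried by κ to (x, X, y, Y), and then by DS to (x, X,
X, F) with tangent part (y, Y, Y, DF(y, Y)), where F and DF are taken at (x, X). The next involution
exchanges the two middle pairs, and Dκ exchanges the middle entries of each half. The foot of κ ξ is
`horProj ξ`, whence the hypothesis that it lies in `D`. -/
theorem IsSemisprayOn.tanChart_completeLift (hS : IsSemisprayOn S D) {x : N}
    {ξ : TangentBundle I.tangent (TangentBundle I N)} (hξ : horProj ξ ∈ D)
    (hx : ξ.1.1 ∈ (extChartAt I x).source) {w : (E × E) × (E × E)}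
    (hw : tanChart I.tangent (zeroVec I x) ξ = w) :
    tanChart I.tangent.tangent (zeroVec I.tangent (zeroVec I x)) (completeLift I S ξ) =
      (w, (w.2, (accel S x (w.1.1, w.2.1),
        fderiv ℝ (accel S x) (w.1.1, w.2.1) (w.1.2, w.2.2)))) := by
  have hfl := tanChart₂_flip₂ hx
  rw [hw] at hfl
  have hh := tanChart_horProj hx
  rw [hw] at hh
  have hxh : (horProj ξ).1 ∈ (extChartAt I x).source := hx
  have hfoot : (S (horProj ξ)).1 = horProj ξ := hS.isField _ hξ
  have hSs : S (horProj ξ) ∈ (tanChart I.tangent (zeroVec I x)).source := by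
    refine mem_tanChart_source.2 (mem_tanChart_source.2 ?_); rwa [hfoot]
  have h1 := tanChart_tangentMap (I := I.tangent) (I' := I.tangent.tangent) (f := S)
    (v := flip₂ I ξ) (x := zeroVec I x) (y := zeroVec I.tangent (zeroVec I x))
    ((hS.contMDiffAt hξ).mdifferentiableAt (by simp)) (mem_tanChart_source.2 hx) hSs
  have hd : fderiv ℝ (tanChart I.tangent (zeroVec I x) ∘ S ∘ (tanChart I x).symm)
      (tanChart I x (horProj ξ)) (w.1.2, w.2.2) =
        ((w.1.2, w.2.2), (w.2.2, fderiv ℝ (accel S x) (w.1.1, w.2.1) (w.1.2, w.2.2))) := by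
    rw [(hS.eventually_rep hξ hxh).fderiv_eq, hh]
    have hF := hS.contDiffAt_accel hξ hxh
    rw [hh] at hF
    have hF' := (hF.differentiableAt (by simp)).hasFDerivAt
    have h := (hasFDerivAt_id (𝕜 := ℝ) (w.1.1, w.2.1)).prodMk
      ((hasFDerivAt_snd (𝕜 := ℝ) (p := (w.1.1, w.2.1))).prodMk hF')
    exact congrArg (fun L : E × E →L[ℝ] (E × E) × (E × E) => L (w.1.2, w.2.2)) h.fderiv
  have h2 : tanChart I.tangent.tangent (zeroVec I.tangent (zeroVec I x))
      (tangentMap I.tangent I.tangent.tangent S (flip₂ I ξ)) =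
      (((w.1.1, w.2.1), (w.2.1, accel S x (w.1.1, w.2.1))),
        ((w.1.2, w.2.2), (w.2.2, fderiv ℝ (accel S x) (w.1.1, w.2.1) (w.1.2, w.2.2)))) := by
    rw [h1]
    refine Prod.ext ?_ ?_
    · refine (hS.tanChart_apply hξ hxh).trans ?_
      rw [hh]
    · rw [hfl]
      exact hd
  have hfoot₂ : (tangentMap I.tangent I.tangent.tangent S (flip₂ I ξ)).1.1 ∈
      (extChartAt I.tangent (zeroVec I x)).source :=
    mem_tanChart_source.1 hSs
  have h3 := tanChart₂_flip₂ (I := I.tangent) (x₀ := zeroVec I x) hfoot₂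
  rw [h2] at h3
  unfold completeLift
  rw [tanChart_tangentMap_flip₂
    (ζ := flip₂ I.tangent (tangentMap I.tangent I.tangent.tangent S (flip₂ I ξ)))
    (mem_tanChart_source.1 hfoot₂), h3]
  rfl

theorem IsSemisprayOn.completeLift_foot (hS : IsSemisprayOn S D)
    {ξ : TangentBundle I.tangent (TangentBundle I N)} (hξ : horProj ξ ∈ D) :
    (completeLift I S ξ).1.1.1 = ξ.1.1 := by
  have hfoot : (S (horProj ξ)).1 = horProj ξ := hS.isField _ hξ
  have h : (S (horProj ξ)).1.1 = (horProj ξ).1 := by rw [hfoot]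
  exact h

theorem continuous_horProj :
    Continuous (horProj : TangentBundle I.tangent (TangentBundle I N) → TangentBundle I N) := by
  have h : ContMDiff I.tangent I 1 (fun η : TangentBundle I N => η.1) :=
    contMDiff_proj (n := 1) (TangentSpace I : N → Type _)
  have := h.continuous_tangentMap (by simp)
  convert this using 1
  exact funext fun ξ => (tangentMap_proj_eq_horProj ξ).symm

/-- The class is closed under complete lifts, with domain pulled back by `horProj`, so everything
proved for `S` applies again to its complete lift. -/
theorem IsSemisprayOn.completeLift (hS : IsSemisprayOn S D) :
    IsSemisprayOn (completeLift I S) (horProj ⁻¹' D) where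
  isOpen := hS.isOpen.preimage continuous_horProj
  smooth := by
    intro ξ hξ
    refine ContMDiffAt.contMDiffWithinAt ?_
    have hsN : ξ.1.1 ∈ (extChartAt I ξ.1.1).source := mem_extChartAt_source _
    have hev := eventually_mem_tanChart₂_source hsN
    have hevD : ∀ᶠ η in 𝓝 ξ, horProj η ∈ D :=
      (hS.isOpen.preimage continuous_horProj).mem_nhds hξ
    have hs : ∀ᶠ η in 𝓝 ξ, _root_.completeLift I S η ∈
        (tanChart I.tangent.tangent (zeroVec I.tangent (zeroVec I ξ.1.1))).source := by
      filter_upwards [hev, hevD] with η hη hηD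
      refine mem_tanChart_source.2 (mem_tanChart₂_source.2 ?_)
      rwa [hS.completeLift_foot hηD]
    let g : (E × E) × (E × E) → ((E × E) × (E × E)) × ((E × E) × (E × E)) := fun w =>
      (w, (w.2, (accel S ξ.1.1 (w.1.1, w.2.1),
        fderiv ℝ (accel S ξ.1.1) (w.1.1, w.2.1) (w.1.2, w.2.2))))
    have he : ∀ᶠ η in 𝓝 ξ, tanChart I.tangent.tangent (zeroVec I.tangent (zeroVec I ξ.1.1))
        (_root_.completeLift I S η) = g (tanChart I.tangent (zeroVec I ξ.1.1) η) := by
      filter_upwards [hev, hevD] with η hη hηD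
      exact hS.tanChart_completeLift hηD hη rfl
    refine contMDiffAt_of_chart (I := I.tangent.tangent) (I' := I.tangent.tangent.tangent) (g := g)
      (mem_tanChart₂_source.2 hsN) hs ?_ he
    have hF := hS.contDiffAt_accel hξ hsN
    rw [tanChart_horProj hsN] at hF
    have hp : ContDiffAt ℝ ∞ (fun w : (E × E) × (E × E) => (w.1.1, w.2.1))
        (tanChart I.tangent (zeroVec I ξ.1.1) ξ) := by fun_prop
    have hF1 := ContDiffAt.comp (tanChart I.tangent (zeroVec I ξ.1.1) ξ) (g := accel S ξ.1.1) hF hp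
    have hF2 := ContDiffAt.comp (tanChart I.tangent (zeroVec I ξ.1.1) ξ)
      (g := fderiv ℝ (accel S ξ.1.1)) (hF.fderiv_right (m := ∞) (by norm_cast)) hp
    exact contDiffAt_id.prodMk (contDiffAt_snd.prodMk
      (hF1.prodMk (hF2.clm_apply (by fun_prop))))
  isField := by
    intro ξ hξ
    have hsN : ξ.1.1 ∈ (extChartAt I ξ.1.1).source := mem_extChartAt_source _
    have hf := hS.completeLift_foot hξ
    have h := hS.tanChart_completeLift hξ hsN rfl
    rw [_root_.tanChart_apply] at h
    refine tanChart_ext (x := zeroVec I ξ.1.1) ?_ (mem_tanChart_source.2 hsN)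
      (congrArg Prod.fst h)
    refine mem_tanChart_source.2 ?_
    rwa [hf]
  isSecondOrder := by
    intro ξ hξ
    have hsN : ξ.1.1 ∈ (extChartAt I ξ.1.1).source := mem_extChartAt_source _
    have hf := hS.completeLift_foot hξ
    have h := hS.tanChart_completeLift hξ hsN rfl
    have hsc : (_root_.completeLift I S ξ).1.1 ∈ (extChartAt I.tangent (zeroVec I ξ.1.1)).source := by
      refine mem_tanChart_source.2 ?_
      rwa [hf]
    have hh := tanChart_horProj (I := I.tangent) hsc
    rw [h] at hh
    exact tanChart_ext (x := zeroVec I ξ.1.1) hsc (mem_tanChart_source.2 hsN) hh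

/-- Needed in a neighbourhood, not just at a point, since the formula is differentiated again for
the second complete lift. -/
theorem IsSemisprayOn.eventually_accel_completeLift (hS : IsSemisprayOn S D) {x : N}
    {ξ : TangentBundle I.tangent (TangentBundle I N)} (hξ : horProj ξ ∈ D)
    (hx : ξ.1.1 ∈ (extChartAt I x).source) :
    ∀ᶠ w in 𝓝 (tanChart I.tangent (zeroVec I x) ξ),
      accel (_root_.completeLift I S) (zeroVec I x) w = (accel S x (w.1.1, w.2.1),
        fderiv ℝ (accel S x) (w.1.1, w.2.1) (w.1.2, w.2.2)) := by
  filter_upwards [eventually_mem_domain hS.completeLift.isOpen hξ (mem_tanChart_source.2 hx)]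
    with w hw
  have hs := mem_tanChart_source.1 (symm_fst_mem_source hw.1)
  have h := hS.tanChart_completeLift hw.2 hs ((tanChart I.tangent (zeroVec I x)).right_inv hw.1)
  exact congrArg (fun a => a.2.2) h

end Semispray

/-! ### Geodesic and Jacobi equations in charts -/

section Geodesics

variable {E : Type*} [NormedAddCommGroup E] [NormedSpace ℝ E]
  {H : Type*} [TopologicalSpace H] {I : ModelWithCorners ℝ E H} [I.Boundaryless]
  {N : Type*} [TopologicalSpace N] [ChartedSpace H N] [IsManifold I ∞ N]

/-- A smooth curve in `N` with `γ'' = S ∘ γ'` and `γ'` in `D`, on the set `s` of times. -/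
structure IsSolutionOn (S : TangentBundle I N → TangentBundle I.tangent (TangentBundle I N))
    (D : Set (TangentBundle I N)) (γ : ℝ → N) (s : Set ℝ) : Prop where
  smooth : ContMDiffOn 𝓘(ℝ, ℝ) I ∞ γ s
  regular : ∀ t ∈ s, velocity I γ t ∈ D
  eq : ∀ t ∈ s, velocity I.tangent (velocity I γ) t = S (velocity I γ t)

variable {S : TangentBundle I N → TangentBundle I.tangent (TangentBundle I N)}
  {D : Set (TangentBundle I N)} {γ : ℝ → N} {s : Set ℝ} {t : ℝ} {x : N}

theorem eventually_mem_chart_source (hγ : ContinuousAt γ t)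
    (hx : γ t ∈ (extChartAt I x).source) : ∀ᶠ r in 𝓝 t, γ r ∈ (extChartAt I x).source :=
  hγ.eventually (extChartAt_source_mem_nhds' hx)

theorem tanChart_comp_velocity (hs : IsOpen s) (hγ : ContMDiffOn 𝓘(ℝ, ℝ) I ∞ γ s) (ht : t ∈ s)
    (hx : γ t ∈ (extChartAt I x).source) :
    tanChart I x ∘ velocity I γ =ᶠ[𝓝 t]
      fun r => ((extChartAt I x ∘ γ) r, deriv (extChartAt I x ∘ γ) r) := by
  filter_upwards [hs.mem_nhds ht, eventually_mem_chart_source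
    (hγ.contMDiffAt (hs.mem_nhds ht)).continuousAt hx] with r hr hrx
  exact tanChart_velocity ((hγ.contMDiffAt (hs.mem_nhds hr)).mdifferentiableAt (by simp)) hrx

theorem ContDiffAt.deriv_infty {F : Type*} [NormedAddCommGroup F] [NormedSpace ℝ F] {c : ℝ → F}
    (hc : ContDiffAt ℝ ∞ c t) : ContDiffAt ℝ ∞ (deriv c) t := by
  have h := (hc.fderiv_right (m := ∞) (by norm_cast)).clm_apply
    (contDiffAt_const (c := (1 : ℝ)))
  exact h

theorem contMDiffAt_velocity (hs : IsOpen s) (hγ : ContMDiffOn 𝓘(ℝ, ℝ) I ∞ γ s) (ht : t ∈ s) :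
    ContMDiffAt 𝓘(ℝ, ℝ) I.tangent ∞ (velocity I γ) t := by
  have hγt := hγ.contMDiffAt (hs.mem_nhds ht)
  have hx : γ t ∈ (extChartAt I (γ t)).source := mem_extChartAt_source _
  have hev := tanChart_comp_velocity hs hγ ht hx
  have hc := contDiffAt_chart_comp hγt hx
  refine contMDiffAt_curve_of_chart (I := I.tangent) (x := zeroVec I (γ t)) ?_ ?_
  · filter_upwards [eventually_mem_chart_source hγt.continuousAt hx] with r hr
    exact mem_tanChart_source.2 hr
  · exact (hc.prodMk hc.deriv_infty).congr_of_eventuallyEq hev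

theorem tanChart₂_velocity_velocity (hs : IsOpen s) (hγ : ContMDiffOn 𝓘(ℝ, ℝ) I ∞ γ s)
    (ht : t ∈ s) (hx : γ t ∈ (extChartAt I x).source) :
    tanChart I.tangent (zeroVec I x) (velocity I.tangent (velocity I γ) t) =
      (tanChart I x (velocity I γ t),
        (deriv (extChartAt I x ∘ γ) t, deriv (deriv (extChartAt I x ∘ γ)) t)) := by
  have hc := contDiffAt_chart_comp (hγ.contMDiffAt (hs.mem_nhds ht)) hx
  have h := tanChart_velocity (I := I.tangent) (x := zeroVec I x)
    ((contMDiffAt_velocity hs hγ ht).mdifferentiableAt (by simp)) (mem_tanChart_source.2 hx)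
  rw [h]
  refine Prod.ext rfl ?_
  refine (tanChart_comp_velocity hs hγ ht hx).deriv_eq.trans ?_
  exact ((hc.differentiableAt (by simp)).hasDerivAt.prodMk
    (hc.deriv_infty.differentiableAt (by simp)).hasDerivAt).deriv

/-- Both sides have foot γ' and horizontal part γ', so only the accelerations are to be compared. -/
theorem IsSemisprayOn.velocity_velocity_eq_iff (hS : IsSemisprayOn S D) (hs : IsOpen s)
    (hγ : ContMDiffOn 𝓘(ℝ, ℝ) I ∞ γ s) (ht : t ∈ s) (hx : γ t ∈ (extChartAt I x).source)
    (hD : velocity I γ t ∈ D) :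
    velocity I.tangent (velocity I γ) t = S (velocity I γ t) ↔
      deriv (deriv (extChartAt I x ∘ γ)) t =
        accel S x ((extChartAt I x ∘ γ) t, deriv (extChartAt I x ∘ γ) t) := by
  have h1 := tanChart₂_velocity_velocity hs hγ ht hx
  have h2 := hS.tanChart_apply hD hx
  have h3 := (tanChart_comp_velocity hs hγ ht hx).self_of_nhds
  simp only [Function.comp_apply] at h3
  constructor
  · intro h
    rw [h, h2] at h1
    have h4 := congrArg (fun a => a.2.2) h1
    simp only [h3] at h4
    exact h4.symm
  · intro h
    refine tanChart_ext (I := I.tangent) (x := zeroVec I x) (mem_tanChart_source.2 hx) ?_ ?_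
    · rw [hS.isField _ hD]; exact mem_tanChart_source.2 hx
    · rw [h1, h2, h3, h]
      rfl

theorem IsSolutionOn.deriv_deriv (hγ : IsSolutionOn S D γ s) (hS : IsSemisprayOn S D)
    (hs : IsOpen s) (ht : t ∈ s) (hx : γ t ∈ (extChartAt I x).source) :
    deriv (deriv (extChartAt I x ∘ γ)) t =
      accel S x ((extChartAt I x ∘ γ) t, deriv (extChartAt I x ∘ γ) t) :=
  (hS.velocity_velocity_eq_iff hs hγ.smooth ht hx (hγ.regular t ht)).1 (hγ.eq t ht)

theorem horProj_velocity {J : ℝ → TangentBundle I N}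
    (hJ : MDifferentiableAt 𝓘(ℝ, ℝ) I.tangent J t) :
    horProj (velocity I.tangent J t) = velocity I (fun r => (J r).1) t := by
  rw [← tangentMap_proj_eq_horProj]
  have h := mfderiv_comp t (mdifferentiable_tangentBundle_proj (J t)) hJ
  exact congrArg (TotalSpace.mk (J t).1) (congrArg (fun L : ℝ →L[ℝ] E => L 1) h).symm

theorem contMDiffOn_foot {J : ℝ → TangentBundle I N} (hJ : ContMDiffOn 𝓘(ℝ, ℝ) I.tangent ∞ J s) :
    ContMDiffOn 𝓘(ℝ, ℝ) I ∞ (fun r => (J r).1) s :=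
  (contMDiff_proj (n := ∞) (TangentSpace I : N → Type _)).comp_contMDiffOn hJ

theorem tanChart_comp_eq (J : ℝ → TangentBundle I N) (x : N) :
    tanChart I x ∘ J = fun r => ((extChartAt I x ∘ fun r => (J r).1) r,
      (tanChart I x (J r)).2) :=
  funext fun r => Prod.ext (by rw [Function.comp_apply, tanChart_apply]; rfl) rfl

theorem deriv_tanChart_comp {J : ℝ → TangentBundle I N}
    (hJ : DifferentiableAt ℝ (fun r => (tanChart I x (J r)).2) t)
    (hf : DifferentiableAt ℝ (extChartAt I x ∘ fun r => (J r).1) t) :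
    deriv (tanChart I x ∘ J) t = (deriv (extChartAt I x ∘ fun r => (J r).1) t,
      deriv (fun r => (tanChart I x (J r)).2) t) := by
  rw [tanChart_comp_eq]
  exact (hf.hasDerivAt.prodMk hJ.hasDerivAt).deriv

theorem deriv_deriv_tanChart_comp {J : ℝ → TangentBundle I N}
    (hJ : ContDiffAt ℝ ∞ (fun r => (tanChart I x (J r)).2) t)
    (hf : ContDiffAt ℝ ∞ (extChartAt I x ∘ fun r => (J r).1) t) :
    deriv (deriv (tanChart I x ∘ J)) t = (deriv (deriv (extChartAt I x ∘ fun r => (J r).1)) t,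
      deriv (deriv (fun r => (tanChart I x (J r)).2)) t) := by
  have hev : deriv (tanChart I x ∘ J) =ᶠ[𝓝 t] fun r =>
      (deriv (extChartAt I x ∘ fun r => (J r).1) r, deriv (fun r => (tanChart I x (J r)).2) r) := by
    have h1 := (hJ.of_le (m := 1) (by simp)).eventually (by simp)
    have h2 := (hf.of_le (m := 1) (by simp)).eventually (by simp)
    filter_upwards [h1, h2] with r hr1 hr2
    exact deriv_tanChart_comp (hr1.differentiableAt (by simp)) (hr2.differentiableAt (by simp))
  rw [hev.deriv_eq]
  exact ((hf.deriv_infty.differentiableAt (by simp)).hasDerivAt.prodMk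
    (hJ.deriv_infty.differentiableAt (by simp)).hasDerivAt).deriv

theorem contDiffAt_tanChart_comp {J : ℝ → TangentBundle I N}
    (hJ : ContMDiffAt 𝓘(ℝ, ℝ) I.tangent ∞ J t) (hx : (J t).1 ∈ (extChartAt I x).source) :
    ContDiffAt ℝ ∞ (fun r => (tanChart I x (J r)).2) t :=
  (contDiffAt_chart_comp (I := I.tangent) (x := zeroVec I x) hJ (mem_tanChart_source.2 hx)).snd

theorem IsSemisprayOn.accel_completeLift (hS : IsSemisprayOn S D) {J : ℝ → TangentBundle I N}
    (hJ : MDifferentiableAt 𝓘(ℝ, ℝ) I.tangent J t) (hx : (J t).1 ∈ (extChartAt I x).source)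
    (hf : DifferentiableAt ℝ (extChartAt I x ∘ fun r => (J r).1) t)
    (hd : DifferentiableAt ℝ (fun r => (tanChart I x (J r)).2) t)
    (hD : velocity I (fun r => (J r).1) t ∈ D) :
    accel (_root_.completeLift I S) (zeroVec I x)
        ((tanChart I x ∘ J) t, deriv (tanChart I x ∘ J) t) =
      (accel S x ((extChartAt I x ∘ fun r => (J r).1) t,
          deriv (extChartAt I x ∘ fun r => (J r).1) t),
        fderiv ℝ (accel S x) ((extChartAt I x ∘ fun r => (J r).1) t,
          deriv (extChartAt I x ∘ fun r => (J r).1) t)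
          ((tanChart I x (J t)).2, deriv (fun r => (tanChart I x (J r)).2) t)) := by
  have hD' : horProj (velocity I.tangent J t) ∈ D := by rwa [horProj_velocity hJ]
  have h := (hS.eventually_accel_completeLift hD' hx).self_of_nhds
  have hv := tanChart_velocity (I := I.tangent) (x := zeroVec I x) hJ (mem_tanChart_source.2 hx)
  rw [hv] at h
  refine h.trans ?_
  have hdv : deriv (extChartAt I.tangent (zeroVec I x) ∘ J) t = _ := deriv_tanChart_comp hd hf
  have hJt : extChartAt I.tangent (zeroVec I x) (J t) = _ := congrFun (tanChart_comp_eq J x) t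
  rw [hdv, hJt]

/-- The Jacobi equation in a chart. -/
theorem IsSolutionOn.jacobi {J : ℝ → TangentBundle I N}
    (hJ : IsSolutionOn (completeLift I S) (horProj ⁻¹' D) J s) (hS : IsSemisprayOn S D)
    (hs : IsOpen s) (ht : t ∈ s) (hx : (J t).1 ∈ (extChartAt I x).source) :
    deriv (deriv (fun r => (tanChart I x (J r)).2)) t =
      fderiv ℝ (accel S x) ((extChartAt I x ∘ fun r => (J r).1) t,
          deriv (extChartAt I x ∘ fun r => (J r).1) t)
        ((tanChart I x (J t)).2, deriv (fun r => (tanChart I x (J r)).2) t) ∧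
    deriv (deriv (extChartAt I x ∘ fun r => (J r).1)) t =
      accel S x ((extChartAt I x ∘ fun r => (J r).1) t,
        deriv (extChartAt I x ∘ fun r => (J r).1) t) := by
  have hJt := hJ.smooth.contMDiffAt (hs.mem_nhds ht)
  have hd := contDiffAt_tanChart_comp hJt hx
  have hf := contDiffAt_chart_comp ((contMDiffOn_foot hJ.smooth).contMDiffAt (hs.mem_nhds ht)) hx
  have hD : velocity I (fun r => (J r).1) t ∈ D := by
    rw [← horProj_velocity (hJt.mdifferentiableAt (by simp))]; exact hJ.regular t ht
  have h1 := hJ.deriv_deriv hS.completeLift hs ht (x := zeroVec I x) (mem_tanChart_source.2 hx)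
  have h2 := hS.accel_completeLift (hJt.mdifferentiableAt (by simp)) hx
    (hf.differentiableAt (by simp)) (hd.differentiableAt (by simp)) hD
  have h3 := (deriv_deriv_tanChart_comp hd hf).symm.trans (h1.trans h2)
  exact ⟨congrArg Prod.snd h3, congrArg Prod.fst h3⟩

/-- The first component of the equation of the complete lift is the original equation. -/
theorem IsSolutionOn.foot {J : ℝ → TangentBundle I N}
    (hJ : IsSolutionOn (completeLift I S) (horProj ⁻¹' D) J s) (hS : IsSemisprayOn S D)
    (hs : IsOpen s) : IsSolutionOn S D (fun r => (J r).1) s where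
  smooth := contMDiffOn_foot hJ.smooth
  regular t ht := by
    rw [← horProj_velocity ((hJ.smooth.contMDiffAt (hs.mem_nhds ht)).mdifferentiableAt (by simp))]
    exact hJ.regular t ht
  eq t ht := by
    refine (hS.velocity_velocity_eq_iff hs (contMDiffOn_foot hJ.smooth) ht
      (mem_extChartAt_source _) ?_).2 (hJ.jacobi hS hs ht (mem_extChartAt_source _)).2
    rw [← horProj_velocity ((hJ.smooth.contMDiffAt (hs.mem_nhds ht)).mdifferentiableAt (by simp))]
    exact hJ.regular t ht

/-- A vector field along a geodesic that satisfies the Jacobi equation in charts is a geodesic of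
the complete lift. -/
theorem IsSolutionOn.of_jacobi {J : ℝ → TangentBundle I N}
    (hγ : IsSolutionOn S D (fun r => (J r).1) s) (hS : IsSemisprayOn S D) (hs : IsOpen s)
    (h : ∀ t ∈ s, ∃ x : N, (J t).1 ∈ (extChartAt I x).source ∧
      ContDiffAt ℝ ∞ (fun r => (tanChart I x (J r)).2) t ∧
      deriv (deriv (fun r => (tanChart I x (J r)).2)) t =
        fderiv ℝ (accel S x) ((extChartAt I x ∘ fun r => (J r).1) t,
          deriv (extChartAt I x ∘ fun r => (J r).1) t)
          ((tanChart I x (J t)).2, deriv (fun r => (tanChart I x (J r)).2) t)) :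
    IsSolutionOn (completeLift I S) (horProj ⁻¹' D) J s := by
  have hsm : ContMDiffOn 𝓘(ℝ, ℝ) I.tangent ∞ J s := by
    intro t ht
    obtain ⟨x, hx, hd, -⟩ := h t ht
    have hγt := hγ.smooth.contMDiffAt (hs.mem_nhds ht)
    have hf := contDiffAt_chart_comp hγt hx
    refine ContMDiffAt.contMDiffWithinAt ?_
    refine contMDiffAt_curve_of_chart (I := I.tangent) (x := zeroVec I x) ?_ ?_
    · filter_upwards [eventually_mem_chart_source hγt.continuousAt hx] with r hr
      exact mem_tanChart_source.2 hr
    · have := hf.prodMk hd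
      rwa [← tanChart_comp_eq] at this
  have hreg : ∀ t ∈ s, velocity I.tangent J t ∈ horProj ⁻¹' D := by
    intro t ht
    rw [mem_preimage, horProj_velocity
      ((hsm.contMDiffAt (hs.mem_nhds ht)).mdifferentiableAt (by simp))]
    exact hγ.regular t ht
  refine ⟨hsm, hreg, fun t ht => ?_⟩
  obtain ⟨x, hx, hd, he⟩ := h t ht
  have hJt := hsm.contMDiffAt (hs.mem_nhds ht)
  have hf := contDiffAt_chart_comp (hγ.smooth.contMDiffAt (hs.mem_nhds ht)) hx
  refine (hS.completeLift.velocity_velocity_eq_iff hs hsm ht (x := zeroVec I x)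
    (mem_tanChart_source.2 hx) (hreg t ht)).2 ?_
  refine (deriv_deriv_tanChart_comp hd hf).trans (Eq.trans ?_
    (hS.accel_completeLift (hJt.mdifferentiableAt (by simp)) hx
    (hf.differentiableAt (by simp)) (hd.differentiableAt (by simp)) (hγ.regular t ht)).symm)
  exact Prod.ext (hγ.deriv_deriv hS hs ht hx) he

/-- The tangent curve of a geodesic is a Jacobi field. -/
theorem IsSolutionOn.isSolutionOn_velocity (hγ : IsSolutionOn S D γ s) (hS : IsSemisprayOn S D)
    (hs : IsOpen s) : IsSolutionOn (completeLift I S) (horProj ⁻¹' D) (velocity I γ) s := by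
  refine IsSolutionOn.of_jacobi (J := velocity I γ) hγ hS hs fun t ht => ?_
  have hγt := hγ.smooth.contMDiffAt (hs.mem_nhds ht)
  have hx : γ t ∈ (extChartAt I (γ t)).source := mem_extChartAt_source _
  have hc := contDiffAt_chart_comp hγt hx
  have hev : (fun r => (tanChart I (γ t) (velocity I γ r)).2) =ᶠ[𝓝 t]
      deriv (extChartAt I (γ t) ∘ γ) := by
    filter_upwards [tanChart_comp_velocity hs hγ.smooth ht hx] with r hr
    exact congrArg Prod.snd hr
  refine ⟨γ t, hx, hc.deriv_infty.congr_of_eventuallyEq hev, ?_⟩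
  -- The geodesic equation c'' = F(c, c') holds near t; differentiating it once gives the Jacobi
  -- equation for c'.
  have hev2 : deriv (deriv (extChartAt I (γ t) ∘ γ)) =ᶠ[𝓝 t] fun r =>
      accel S (γ t) ((extChartAt I (γ t) ∘ γ) r, deriv (extChartAt I (γ t) ∘ γ) r) := by
    filter_upwards [hs.mem_nhds ht, eventually_mem_chart_source hγt.continuousAt hx] with r hr hrx
    exact hγ.deriv_deriv hS hs hr hrx
  have hF := hS.contDiffAt_accel (hγ.regular t ht) hx
  have hv : tanChart I (γ t) (velocity I γ t) = _ :=
    (tanChart_comp_velocity hs hγ.smooth ht hx).self_of_nhds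
  rw [hv] at hF
  rw [hev.deriv.deriv_eq, hev.deriv_eq, hev2.deriv_eq, hv]
  have h1 := (hc.differentiableAt (by simp)).hasDerivAt.prodMk
    (hc.deriv_infty.differentiableAt (by simp)).hasDerivAt
  exact ((hF.differentiableAt (by simp)).hasFDerivAt.comp_hasDerivAt t h1).deriv

end Geodesics

/-! ### Jacobi fields of the complete lift -/

section Lifts

variable {E : Type*} [NormedAddCommGroup E] [NormedSpace ℝ E]
  {H : Type*} [TopologicalSpace H] {I : ModelWithCorners ℝ E H} [I.Boundaryless]
  {N : Type*} [TopologicalSpace N] [ChartedSpace H N] [IsManifold I ∞ N]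
  {S : TangentBundle I N → TangentBundle I.tangent (TangentBundle I N)}
  {D : Set (TangentBundle I N)} {s : Set ℝ} {t : ℝ} {x : N}

/-- The map differentiated is the acceleration of the complete lift when F is that of `S`. Its
derivative supplies the linearized equation one level up, with D²F as coupling term. -/
theorem fderiv_tangentRep {F : E × E → E} {w : (E × E) × (E × E)}
    (hF : ContDiffAt ℝ ∞ F (w.1.1, w.2.1)) (k : (E × E) × (E × E)) :
    fderiv ℝ (fun w : (E × E) × (E × E) =>
        (F (w.1.1, w.2.1), fderiv ℝ F (w.1.1, w.2.1) (w.1.2, w.2.2))) w k =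
      (fderiv ℝ F (w.1.1, w.2.1) (k.1.1, k.2.1),
        fderiv ℝ (fderiv ℝ F) (w.1.1, w.2.1) (k.1.1, k.2.1) (w.1.2, w.2.2) +
        fderiv ℝ F (w.1.1, w.2.1) (k.1.2, k.2.2)) := by
  let A : (E × E) × (E × E) →L[ℝ] E × E :=
    ((ContinuousLinearMap.fst ℝ E E).comp (ContinuousLinearMap.fst ℝ (E × E) (E × E))).prod
      ((ContinuousLinearMap.fst ℝ E E).comp (ContinuousLinearMap.snd ℝ (E × E) (E × E)))
  let B : (E × E) × (E × E) →L[ℝ] E × E :=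
    ((ContinuousLinearMap.snd ℝ E E).comp (ContinuousLinearMap.fst ℝ (E × E) (E × E))).prod
      ((ContinuousLinearMap.snd ℝ E E).comp (ContinuousLinearMap.snd ℝ (E × E) (E × E)))
  have h1 : HasFDerivAt F (fderiv ℝ F (A w)) (A w) :=
    (hF.differentiableAt (by simp)).hasFDerivAt
  have h2 : HasFDerivAt (fderiv ℝ F) (fderiv ℝ (fderiv ℝ F) (A w)) (A w) :=
    ((hF.fderiv_right (m := 1) (by norm_cast)).differentiableAt (by simp)).hasFDerivAt
  have h3 := (h1.comp w A.hasFDerivAt).prodMk ((h2.comp w A.hasFDerivAt).clm_apply B.hasFDerivAt)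
  refine (congrArg (fun L : (E × E) × (E × E) →L[ℝ] E × E => L k) h3.fderiv).trans ?_
  exact Prod.ext rfl (add_comm _ _)

theorem IsSolutionOn.fderiv_accel_completeLift {J : ℝ → TangentBundle I N}
    (hJ : IsSolutionOn (completeLift I S) (horProj ⁻¹' D) J s) (hS : IsSemisprayOn S D)
    (hs : IsOpen s) (ht : t ∈ s) (hx : (J t).1 ∈ (extChartAt I x).source) (k l : E × E) :
    fderiv ℝ (accel (completeLift I S) (zeroVec I x))
        ((extChartAt I.tangent (zeroVec I x) ∘ J) t,
          deriv (extChartAt I.tangent (zeroVec I x) ∘ J) t) (k, l) =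
      (fderiv ℝ (accel S x) ((extChartAt I x ∘ fun r => (J r).1) t,
          deriv (extChartAt I x ∘ fun r => (J r).1) t) (k.1, l.1),
        fderiv ℝ (fderiv ℝ (accel S x)) ((extChartAt I x ∘ fun r => (J r).1) t,
          deriv (extChartAt I x ∘ fun r => (J r).1) t) (k.1, l.1)
          ((tanChart I x (J t)).2, deriv (fun r => (tanChart I x (J r)).2) t) +
        fderiv ℝ (accel S x) ((extChartAt I x ∘ fun r => (J r).1) t,
          deriv (extChartAt I x ∘ fun r => (J r).1) t) (k.2, l.2)) := by
  have hJt := hJ.smooth.contMDiffAt (hs.mem_nhds ht)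
  have hd := contDiffAt_tanChart_comp hJt hx
  have hf := contDiffAt_chart_comp ((contMDiffOn_foot hJ.smooth).contMDiffAt (hs.mem_nhds ht)) hx
  have hD : horProj (velocity I.tangent J t) ∈ D := hJ.regular t ht
  have hev := hS.eventually_accel_completeLift hD hx
  have hF := hS.contDiffAt_accel hD hx
  rw [tanChart_horProj hx] at hF
  have hdv : deriv (extChartAt I.tangent (zeroVec I x) ∘ J) t = _ :=
    deriv_tanChart_comp (hd.differentiableAt (by simp)) (hf.differentiableAt (by simp))
  have hJx : extChartAt I.tangent (zeroVec I x) (J t) = _ := congrFun (tanChart_comp_eq J x) t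
  have hv := tanChart_velocity (I := I.tangent) (x := zeroVec I x)
    (hJt.mdifferentiableAt (by simp)) (mem_tanChart_source.2 hx)
  rw [hdv, hJx] at hv
  rw [hv] at hev hF
  have h := Filter.EventuallyEq.fderiv_eq (𝕜 := ℝ) hev
  rw [Function.comp_apply, hdv, hJx, h, fderiv_tangentRep hF]

variable {J : ℝ → TangentBundle I N}
  {K : ℝ → TangentBundle I.tangent (TangentBundle I N)}

/-- With horizontal part 0 the coupling term vanishes, and what remains is the Jacobi equation of W.
It does not involve J, so J may be any Jacobi field over the same curve. -/
theorem IsSolutionOn.comp_vertLift {W : ℝ → TangentBundle I N}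
    (hJ : IsSolutionOn (completeLift I S) (horProj ⁻¹' D) J s)
    (hW : IsSolutionOn (completeLift I S) (horProj ⁻¹' D) W s) (hS : IsSemisprayOn S D)
    (hs : IsOpen s) (hJW : ∀ t ∈ s, (W t).1 = (J t).1) :
    IsSolutionOn (completeLift I.tangent (completeLift I S)) (horProj ⁻¹' (horProj ⁻¹' D))
      (fun r => vertLift (J r) (W r)) s := by
  refine IsSolutionOn.of_jacobi (J := fun r => vertLift (J r) (W r)) hJ hS.completeLift hs
    fun t ht => ?_
  have hx : (J t).1 ∈ (extChartAt I (J t).1).source := mem_extChartAt_source _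
  have hx' : (W t).1 ∈ (extChartAt I (J t).1).source := by rw [hJW t ht]; exact hx
  have hft := (contMDiffOn_foot hJ.smooth).contMDiffAt (hs.mem_nhds ht)
  have hd := contDiffAt_tanChart_comp (hW.smooth.contMDiffAt (hs.mem_nhds ht)) hx'
  have hev : (fun r => (tanChart I.tangent (zeroVec I (J t).1) (vertLift (J r) (W r))).2)
      =ᶠ[𝓝 t] fun r => (0, (tanChart I (J t).1 (W r)).2) := by
    filter_upwards [hs.mem_nhds ht, eventually_mem_chart_source hft.continuousAt hx] with r hr hrx
    rw [tanChart₂_vertLift hrx (hJW r hr)]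
  have hd1 : ∀ᶠ r in 𝓝 t, DifferentiableAt ℝ (fun r => (tanChart I (J t).1 (W r)).2) r := by
    filter_upwards [(hd.of_le (m := 1) (by simp)).eventually (by simp)] with r hr
    exact hr.differentiableAt (by simp)
  have hev1 : deriv (fun r => (tanChart I.tangent (zeroVec I (J t).1)
      (vertLift (J r) (W r))).2) =ᶠ[𝓝 t]
        fun r => (0, deriv (fun r => (tanChart I (J t).1 (W r)).2) r) := by
    filter_upwards [hev.deriv, hd1] with r hr hr1
    rw [hr]
    exact ((hasDerivAt_const r (0 : E)).prodMk hr1.hasDerivAt).deriv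
  refine ⟨zeroVec I (J t).1, mem_tanChart_source.2 hx,
    (contDiffAt_const.prodMk hd).congr_of_eventuallyEq hev, ?_⟩
  have hfW : (extChartAt I (J t).1 ∘ fun r => (W r).1) =ᶠ[𝓝 t]
      extChartAt I (J t).1 ∘ fun r => (J r).1 := by
    filter_upwards [hs.mem_nhds ht] with r hr
    simp only [Function.comp_apply, hJW r hr]
  have hjac := (hW.jacobi hS hs ht hx').1
  rw [hfW.deriv_eq, hfW.self_of_nhds] at hjac
  have hev0 : (tanChart I.tangent (zeroVec I (J t).1) (vertLift (J t) (W t))).2 = _ :=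
    hev.self_of_nhds
  rw [hev1.deriv_eq, hev1.self_of_nhds, hev0]
  refine Eq.trans ?_ (hJ.fderiv_accel_completeLift hS hs ht hx _ _).symm
  refine ((hasDerivAt_const t (0 : E)).prodMk
    (hd.deriv_infty.differentiableAt (by simp)).hasDerivAt).deriv.trans ?_
  rw [hjac]
  simp only [Prod.mk_zero_zero, map_zero, zero_apply, zero_add]

/-- The components of a Jacobi field of the complete lift satisfy the linearized equation. -/
theorem IsSolutionOn.jacobi₂
    (hK : IsSolutionOn (completeLift I.tangent (completeLift I S)) (horProj ⁻¹' (horProj ⁻¹' D)) K s)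
    (hS : IsSemisprayOn S D) (hs : IsOpen s) (ht : t ∈ s)
    (hx : (K t).1.1 ∈ (extChartAt I x).source) :
    deriv (deriv (fun r => (tanChart I.tangent (zeroVec I x) (K r)).2.1)) t =
      fderiv ℝ (accel S x) ((extChartAt I x ∘ fun r => (K r).1.1) t,
          deriv (extChartAt I x ∘ fun r => (K r).1.1) t)
        ((tanChart I.tangent (zeroVec I x) (K t)).2.1,
          deriv (fun r => (tanChart I.tangent (zeroVec I x) (K r)).2.1) t) ∧
    deriv (deriv (fun r => (tanChart I.tangent (zeroVec I x) (K r)).2.2)) t =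
      fderiv ℝ (fderiv ℝ (accel S x)) ((extChartAt I x ∘ fun r => (K r).1.1) t,
          deriv (extChartAt I x ∘ fun r => (K r).1.1) t)
        ((tanChart I.tangent (zeroVec I x) (K t)).2.1,
          deriv (fun r => (tanChart I.tangent (zeroVec I x) (K r)).2.1) t)
        ((tanChart I x (K t).1).2, deriv (fun r => (tanChart I x (K r).1).2) t) +
      fderiv ℝ (accel S x) ((extChartAt I x ∘ fun r => (K r).1.1) t,
          deriv (extChartAt I x ∘ fun r => (K r).1.1) t)
        ((tanChart I.tangent (zeroVec I x) (K t)).2.2,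
          deriv (fun r => (tanChart I.tangent (zeroVec I x) (K r)).2.2) t) := by
  have hJ := hK.foot hS.completeLift hs
  have hk := contDiffAt_tanChart_comp (x := zeroVec I x) (hK.smooth.contMDiffAt (hs.mem_nhds ht))
    (mem_tanChart_source.2 hx)
  have hd1 : deriv (fun r => (tanChart I.tangent (zeroVec I x) (K r)).2) =ᶠ[𝓝 t] fun r =>
      (deriv (fun r => (tanChart I.tangent (zeroVec I x) (K r)).2.1) r,
        deriv (fun r => (tanChart I.tangent (zeroVec I x) (K r)).2.2) r) := by
    filter_upwards [(hk.of_le (m := 1) (by simp)).eventually (by simp)] with r hr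
    have h := hr.differentiableAt (by simp)
    exact (h.fst.hasDerivAt.prodMk h.snd.hasDerivAt).deriv
  have hjac := (hK.jacobi hS.completeLift hs ht (x := zeroVec I x) (mem_tanChart_source.2 hx)).1
  have h2 := hJ.fderiv_accel_completeLift hS hs ht hx
    ((tanChart I.tangent (zeroVec I x) (K t)).2)
    (deriv (fun r => (tanChart I.tangent (zeroVec I x) (K r)).2) t)
  have h3 := hjac.trans h2
  rw [hd1.deriv_eq, hd1.self_of_nhds] at h3
  have h4 := ((hk.fst.deriv_infty.differentiableAt (by simp)).hasDerivAt.prodMk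
    (hk.snd.deriv_infty.differentiableAt (by simp)).hasDerivAt).deriv.symm.trans h3
  exact ⟨congrArg Prod.fst h4, congrArg Prod.snd h4⟩

/-- The equation for the horizontal part U involves neither y nor V: it is the Jacobi equation along
the base curve. -/
theorem IsSolutionOn.comp_horProj
    (hK : IsSolutionOn (completeLift I.tangent (completeLift I S)) (horProj ⁻¹' (horProj ⁻¹' D)) K s)
    (hS : IsSemisprayOn S D) (hs : IsOpen s) :
    IsSolutionOn (completeLift I S) (horProj ⁻¹' D) (fun r => horProj (K r)) s := by
  have hJ := hK.foot hS.completeLift hs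
  refine IsSolutionOn.of_jacobi (J := fun r => horProj (K r)) (hJ.foot hS hs) hS hs
    fun t ht => ?_
  have hx : (K t).1.1 ∈ (extChartAt I (K t).1.1).source := mem_extChartAt_source _
  have hft := (contMDiffOn_foot hJ.smooth).contMDiffAt (hs.mem_nhds ht)
  have hk := contDiffAt_tanChart_comp (x := zeroVec I (K t).1.1)
    (hK.smooth.contMDiffAt (hs.mem_nhds ht)) (mem_tanChart_source.2 hx)
  have hev : (fun r => (tanChart I (K t).1.1 (horProj (K r))).2) =ᶠ[𝓝 t]
      fun r => (tanChart I.tangent (zeroVec I (K t).1.1) (K r)).2.1 := by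
    filter_upwards [eventually_mem_chart_source hft.continuousAt hx] with r hr
    rw [tanChart_horProj hr]
  refine ⟨(K t).1.1, hx, hk.fst.congr_of_eventuallyEq hev, ?_⟩
  have h0 := hev.self_of_nhds
  simp only at h0
  rw [hev.deriv.deriv_eq, hev.deriv_eq, h0]
  exact (hK.jacobi₂ hS hs ht hx).1

/-- When U vanishes identically, so does U', and the D²F term disappears from the equation for V. -/
theorem IsSolutionOn.comp_vertProj
    (hK : IsSolutionOn (completeLift I.tangent (completeLift I S)) (horProj ⁻¹' (horProj ⁻¹' D)) K s)
    (hS : IsSemisprayOn S D) (hs : IsOpen s) (h0 : ∀ t ∈ s, (horProj (K t)).2 = 0) :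
    IsSolutionOn (completeLift I S) (horProj ⁻¹' D) (fun r => vertProj (K r)) s := by
  have hJ := hK.foot hS.completeLift hs
  refine IsSolutionOn.of_jacobi (J := fun r => vertProj (K r)) (hJ.foot hS hs) hS hs
    fun t ht => ?_
  have hx : (K t).1.1 ∈ (extChartAt I (K t).1.1).source := mem_extChartAt_source _
  have hft := (contMDiffOn_foot hJ.smooth).contMDiffAt (hs.mem_nhds ht)
  have hk := contDiffAt_tanChart_comp (x := zeroVec I (K t).1.1)
    (hK.smooth.contMDiffAt (hs.mem_nhds ht)) (mem_tanChart_source.2 hx)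
  have hev : (fun r => (tanChart I (K t).1.1 (vertProj (K r))).2) =ᶠ[𝓝 t]
      fun r => (tanChart I.tangent (zeroVec I (K t).1.1) (K r)).2.2 := by
    filter_upwards [hs.mem_nhds ht, eventually_mem_chart_source hft.continuousAt hx] with r hr hrx
    rw [tanChart_vertProj hrx (h0 r hr)]
  have hev0 : (fun r => (tanChart I.tangent (zeroVec I (K t).1.1) (K r)).2.1) =ᶠ[𝓝 t]
      fun _ => (0 : E) := by
    filter_upwards [hs.mem_nhds ht, eventually_mem_chart_source hft.continuousAt hx] with r hr hrx
    have h1 := (tanChart_snd_eq_zero_iff (v := horProj (K r)) hrx).2 (h0 r hr)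
    rwa [tanChart_horProj hrx] at h1
  refine ⟨(K t).1.1, hx, hk.snd.congr_of_eventuallyEq hev, ?_⟩
  have h1 := hev.self_of_nhds
  have h2 := hev0.self_of_nhds
  simp only at h1 h2
  have hjac := (hK.jacobi₂ hS hs ht hx).2
  rw [hev0.deriv_eq, h2, deriv_const, Prod.mk_zero_zero, map_zero] at hjac
  rw [hev.deriv.deriv_eq, hev.deriv_eq, h1]
  exact hjac.trans (zero_add (M := E) _)

end Lifts

/-! ### Uniqueness for the Jacobi equation -/

section Uniqueness

variable {E : Type*} [NormedAddCommGroup E] [NormedSpace ℝ E]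

/-- A solution of a second order linear equation that vanishes to first order vanishes. -/
theorem eventually_eq_zero_of_linear {A : ℝ → E × E →L[ℝ] E} {u : ℝ → E} {t : ℝ}
    (hA : ContinuousAt A t) (hu : ContDiffAt ℝ ∞ u t)
    (h : ∀ᶠ r in 𝓝 t, deriv (deriv u) r = A r (u r, deriv u r)) (h0 : u t = 0)
    (h1 : deriv u t = 0) : ∀ᶠ r in 𝓝 t, u r = 0 := by
  have hb : ∀ᶠ r in 𝓝 t, ‖A r‖ < ‖A t‖ + 1 :=
    hA.norm.eventually (gt_mem_nhds (lt_add_one _))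
  have hd1 := (hu.of_le (m := 1) (by simp)).eventually (by simp)
  have hd2 := (hu.deriv_infty.of_le (m := 1) (by simp)).eventually (by simp)
  -- First order system for (u, u'). Its Lipschitz constant is the maximum of 1, from w ↦ w.2, and
  -- ‖A t‖ + 1, which bounds ‖A r‖ for r near t.
  let v : ℝ → E × E → E × E := fun r w => (w.2, A r w)
  have hlip : ∀ᶠ r in 𝓝 t, LipschitzOnWith (max 1 (‖A t‖₊ + 1)) (v r) univ := by
    filter_upwards [hb] with r hr
    have hAr : LipschitzWith (‖A t‖₊ + 1) (A r) := by
      refine (A r).lipschitz.weaken ?_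
      rw [← NNReal.coe_le_coe]
      exact hr.le
    exact (LipschitzWith.prod_snd.prodMk hAr).lipschitzOnWith
  have hsol := ODE_solution_unique_of_eventually (t₀ := t) (v := v) (s := fun _ => univ)
    (f := fun r => (u r, deriv u r)) (g := fun _ => 0) hlip ?_ ?_ (by simp [h0, h1])
  · filter_upwards [hsol] with r hr
    exact congrArg Prod.fst hr
  · filter_upwards [hd1, hd2, h] with r hr1 hr2 hr
    refine ⟨?_, mem_univ _⟩
    have h2 := (hr2.differentiableAt (by simp)).hasDerivAt
    rw [hr] at h2
    exact (hr1.differentiableAt (by simp)).hasDerivAt.prodMk h2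
  · refine .of_forall fun r => ⟨?_, mem_univ _⟩
    have : v r 0 = 0 := by simp [v]
    rw [this]
    exact hasDerivAt_const _ _

variable {H : Type*} [TopologicalSpace H] {I : ModelWithCorners ℝ E H} [I.Boundaryless]
  {N : Type*} [TopologicalSpace N] [ChartedSpace H N] [IsManifold I ∞ N]
  {S : TangentBundle I N → TangentBundle I.tangent (TangentBundle I N)}
  {D : Set (TangentBundle I N)} {s : Set ℝ} {t₀ : ℝ} {J : ℝ → TangentBundle I N}

/-- A Jacobi field that vanishes on an interval of positive length vanishes. -/
theorem IsSolutionOn.eq_zero (hJ : IsSolutionOn (completeLift I S) (horProj ⁻¹' D) J s)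
    (hS : IsSemisprayOn S D) (hs : IsOpen s) (hsc : IsPreconnected s) (ht₀ : t₀ ∈ s)
    (h0 : ∀ᶠ r in 𝓝 t₀, (J r).2 = 0) : ∀ t ∈ s, (J t).2 = 0 := by
  -- Z is open by construction; by connectedness of `s` it remains to show that it is closed
  -- relative to `s`.
  let Z : Set ℝ := {t | ∀ᶠ r in 𝓝 t, (J r).2 = 0}
  have hZ : IsOpen Z := isOpen_setOfPred_eventually_nhds
  suffices hsZ : s ⊆ Z from fun t ht => (hsZ ht).self_of_nhds
  refine hsc.subset_of_closure_inter_subset hZ ⟨t₀, ht₀, h0⟩ ?_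
  rintro t ⟨htZ, ht⟩
  have hx : (J t).1 ∈ (extChartAt I (J t).1).source := mem_extChartAt_source _
  have hJt := hJ.smooth.contMDiffAt (hs.mem_nhds ht)
  have hft := (contMDiffOn_foot hJ.smooth).contMDiffAt (hs.mem_nhds ht)
  have hsrc := eventually_mem_chart_source hft.continuousAt hx
  have hu := contDiffAt_tanChart_comp hJt hx
  have hc := contDiffAt_chart_comp hft hx
  set u : ℝ → E := fun r => (tanChart I (J t).1 (J r)).2 with hu_def
  have hiff : ∀ᶠ r in 𝓝 t, u r = 0 ↔ (J r).2 = 0 := by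
    filter_upwards [hsrc] with r hr
    exact tanChart_snd_eq_zero_iff hr
  -- Near a point of Z both u and u' vanish; since t is a limit of such points, continuity gives
  -- zero initial data at t.
  have hfreq : ∃ᶠ r in 𝓝 t, u r = 0 ∧ deriv u r = 0 := by
    have h1 : ∃ᶠ r in 𝓝 t, r ∈ Z := mem_closure_iff_frequently.1 htZ
    refine (h1.and_eventually hiff.eventually_nhds).mono fun r hr => ?_
    have h2 : u =ᶠ[𝓝 r] fun _ => 0 := by
      filter_upwards [hr.1, hr.2] with q hq hq'
      exact hq'.2 hq
    exact ⟨h2.self_of_nhds, by rw [h2.deriv_eq, deriv_const]⟩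
  have hcont : ContinuousAt (fun r => (u r, deriv u r)) t :=
    hu.continuousAt.prodMk hu.deriv_infty.continuousAt
  have hz : (u t, deriv u t) = 0 := by
    have : ∃ᶠ r in 𝓝 t, (u r, deriv u r) ∈ ({0} : Set (E × E)) :=
      hfreq.mono fun r hr => by simp [hr.1, hr.2]
    exact isClosed_singleton.mem_of_frequently_of_tendsto this hcont
  have hF := hS.contDiffAt_accel (hJ.regular t ht) hx
  rw [horProj_velocity (hJt.mdifferentiableAt (by simp)),
    tanChart_velocity (hft.mdifferentiableAt (by simp)) hx] at hF
  have hA : ContinuousAt (fun r => fderiv ℝ (accel S (J t).1)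
      ((extChartAt I (J t).1 ∘ fun r => (J r).1) r,
        deriv (extChartAt I (J t).1 ∘ fun r => (J r).1) r)) t :=
    ContinuousAt.comp (g := fderiv ℝ (accel S (J t).1))
      (hF.fderiv_right (m := ∞) (by norm_cast)).continuousAt
      (hc.continuousAt.prodMk hc.deriv_infty.continuousAt)
  have hzero := eventually_eq_zero_of_linear hA hu ?_ (congrArg Prod.fst hz) (congrArg Prod.snd hz)
  · show ∀ᶠ r in 𝓝 t, (J r).2 = 0
    filter_upwards [hzero, hiff] with r hr hr'
    exact hr'.1 hr
  · filter_upwards [hs.mem_nhds ht, hsrc] with r hr hrx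
    exact (hJ.jacobi hS hs hr hrx).1

end Uniqueness

/-! ### Slashed tangent bundles and the transfer of vanishing Jacobi fields -/

section Slashed

variable {E : Type*} [NormedAddCommGroup E] [NormedSpace ℝ E]
  {H : Type*} [TopologicalSpace H] {I : ModelWithCorners ℝ E H} [I.Boundaryless]
  {N : Type*} [TopologicalSpace N] [ChartedSpace H N] [IsManifold I ∞ N]
  {E₀ : Type*} [NormedAddCommGroup E₀] [NormedSpace ℝ E₀] {H₀ : Type*}
  [TopologicalSpace H₀] {I₀ : ModelWithCorners ℝ E₀ H₀} [I₀.Boundaryless] {M : Type*}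
  [TopologicalSpace M] [ChartedSpace H₀ M] [IsManifold I₀ ∞ M] {p : N → M}
  {S : TangentBundle I N → TangentBundle I.tangent (TangentBundle I N)}

theorem isOpen_nonzero_vectors : IsOpen {v : TangentBundle I N | v.2 ≠ 0} := by
  refine isOpen_iff_mem_nhds.2 fun v hv => ?_
  have hx : v.1 ∈ (extChartAt I v.1).source := mem_extChartAt_source _
  have hs : v ∈ (tanChart I v.1).source := mem_tanChart_source.2 hx
  have h1 : ∀ᶠ w in 𝓝 v, w ∈ (tanChart I v.1).source :=
    extChartAt_source_mem_nhds' (I := I.tangent) hs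
  have h2 : ContinuousAt (tanChart I v.1) v := continuousAt_extChartAt' (I := I.tangent) hs
  have h3 : ∀ᶠ w in 𝓝 v, (tanChart I v.1 w).2 ≠ 0 :=
    h2.snd.eventually_ne (mt (tanChart_snd_eq_zero_iff hx).1 hv)
  filter_upwards [h1, h3] with w hw1 hw3
  exact mt (tanChart_snd_eq_zero_iff (mem_tanChart_source.1 hw1)).2 hw3

theorem isOpen_slashed (hp : ContMDiff I I₀ ∞ p) : IsOpen (slashed I I₀ p) :=
  isOpen_nonzero_vectors.preimage (hp.continuous_tangentMap (by simp))

/-- Chain rule for p ∘ π. It identifies the slashed domain of the complete lift with the pulled-back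
domain of `IsSemisprayOn.completeLift`. -/
theorem slashed_tangent (hp : ContMDiff I I₀ ∞ p) :
    slashed I.tangent I₀ (fun ξ : TangentBundle I N => p ξ.1) = horProj ⁻¹' slashed I I₀ p := by
  ext ξ
  have h := mfderiv_comp ξ.1 (hp.mdifferentiable (by simp) ξ.1.1)
    (mdifferentiable_tangentBundle_proj (I := I) ξ.1)
  have h2 : (tangentMap I.tangent I₀ (fun ξ : TangentBundle I N => p ξ.1) ξ).2 =
      (tangentMap I I₀ p (horProj ξ)).2 := by
    rw [← tangentMap_proj_eq_horProj]
    exact congrArg (fun L : E × E →L[ℝ] E₀ => L ξ.2) h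
  exact not_congr (Eq.congr_left h2)

theorem IsSpray.isSemisprayOn (hS : IsSpray I I₀ p S) (hp : ContMDiff I I₀ ∞ p) :
    IsSemisprayOn S (slashed I I₀ p) where
  isOpen := isOpen_slashed hp
  smooth := hS.smooth
  isField := hS.isField
  isSecondOrder ξ hξ := by rw [← tangentMap_proj_eq_horProj]; exact hS.isSecondOrder ξ hξ

theorem isGeodesicOn_iff {γ : ℝ → N} {s : Set ℝ} :
    IsGeodesicOn I I₀ p S γ s ↔ IsSolutionOn S (slashed I I₀ p) γ s :=
  ⟨fun h => ⟨h.smooth, h.regular, h.eq⟩, fun h => ⟨h.smooth, h.regular, h.eq⟩⟩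

theorem isGeodesicOn_completeLift_iff (hp : ContMDiff I I₀ ∞ p) {J : ℝ → TangentBundle I N}
    {s : Set ℝ} :
    IsGeodesicOn I.tangent I₀ (fun ξ : TangentBundle I N => p ξ.1) (completeLift I S) J s ↔
      IsSolutionOn (completeLift I S) (horProj ⁻¹' slashed I I₀ p) J s := by
  rw [isGeodesicOn_iff, slashed_tangent hp]

theorem contMDiff_comp_proj (hp : ContMDiff I I₀ ∞ p) :
    ContMDiff I.tangent I₀ ∞ (fun ξ : TangentBundle I N => p ξ.1) :=
  hp.comp (contMDiff_proj (TangentSpace I : N → Type _))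

theorem isGeodesicOn_completeLift₂_iff (hp : ContMDiff I I₀ ∞ p)
    {K : ℝ → TangentBundle I.tangent (TangentBundle I N)} {s : Set ℝ} :
    IsGeodesicOn I.tangent.tangent I₀
        (fun ξ : TangentBundle I.tangent (TangentBundle I N) => p ξ.1.1)
        (completeLift I.tangent (completeLift I S)) K s ↔
      IsSolutionOn (completeLift I.tangent (completeLift I S))
        (horProj ⁻¹' (horProj ⁻¹' slashed I I₀ p)) K s := by
  rw [← slashed_tangent hp]
  exact isGeodesicOn_completeLift_iff (I := I.tangent) (contMDiff_comp_proj hp)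

/-- The vertical lift of a vanishing Jacobi field along another Jacobi field is a vanishing Jacobi
field of the complete lift. -/
theorem hasVanishingJacobi_vertLift (hS : IsSemisprayOn S (slashed I I₀ p))
    (hp : ContMDiff I I₀ ∞ p) {L α β : ℝ} (hL : 0 < L) (hα : α < 0) (hβ : L < β)
    {J W : ℝ → TangentBundle I N}
    (hJ : IsSolutionOn (completeLift I S) (horProj ⁻¹' slashed I I₀ p) J (Ioo α β))
    (hW : IsSolutionOn (completeLift I S) (horProj ⁻¹' slashed I I₀ p) W (Ioo α β))
    (hJW : ∀ t ∈ Ioo α β, (W t).1 = (J t).1) (hW0 : (W 0).2 = 0) (hWL : (W L).2 = 0)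
    (hne : ∃ t ∈ Icc 0 L, (W t).2 ≠ 0) :
    HasVanishingJacobi I.tangent I₀ (fun ξ : TangentBundle I N => p ξ.1) (completeLift I S)
      (J 0) (J L) := by
  have hK := hJ.comp_vertLift hW hS isOpen_Ioo hJW
  obtain ⟨t, ht, hWt⟩ := hne
  refine ⟨L, hL, α, hα, β, hβ, J, fun r => vertLift (J r) (W r),
    (isGeodesicOn_completeLift_iff hp).2 hJ, rfl, rfl,
    ⟨(isGeodesicOn_completeLift₂_iff hp).2 hK, fun t _ => rfl⟩, ?_, ?_, t, ht, ?_⟩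
  · exact Prod.ext rfl hW0
  · exact Prod.ext rfl hWL
  · exact fun h => hWt (congrArg Prod.snd h)

theorem HasVanishingJacobi.completeLift_zero {a b : N} (h : HasVanishingJacobi I I₀ p S a b)
    (hS : IsSpray I I₀ p S) (hp : ContMDiff I I₀ ∞ p) :
    HasVanishingJacobi I.tangent I₀ (fun ξ : TangentBundle I N => p ξ.1) (completeLift I S)
      (zeroVec I a) (zeroVec I b) := by
  obtain ⟨L, hL, α, hα, β, hβ, γ, J, hγ, rfl, rfl, hJ, hJ0, hJL, hne⟩ := h
  have hJs := (isGeodesicOn_completeLift_iff hp).1 hJ.geodesic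
  -- The field is lifted along itself, so the new base geodesic J starts and ends at zero vectors.
  have h := hasVanishingJacobi_vertLift (hS.isSemisprayOn hp) hp hL hα hβ hJs hJs
    (fun _ _ => rfl) hJ0 hJL hne
  have key : ∀ t ∈ Ioo α β, (J t).2 = 0 → J t = zeroVec I (γ t) := by
    intro t ht h0
    rw [← hJ.proj t ht]
    exact congrArg (TotalSpace.mk (J t).1) h0
  rwa [key 0 ⟨hα, hL.trans hβ⟩ hJ0, key L ⟨hα.trans hL, hβ⟩ hJL] at h

theorem HasVanishingJacobi.completeLift_nonzero {a b : N} (h : HasVanishingJacobi I I₀ p S a b)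
    (hS : IsSpray I I₀ p S) (hp : ContMDiff I I₀ ∞ p) :
    ∃ ξ η : TangentBundle I N, ξ.1 = a ∧ η.1 = b ∧ ξ ≠ zeroVec I a ∧ η ≠ zeroVec I b ∧
      HasVanishingJacobi I.tangent I₀ (fun ξ : TangentBundle I N => p ξ.1) (completeLift I S)
        ξ η := by
  obtain ⟨L, hL, α, hα, β, hβ, γ, J, hγ, rfl, rfl, hJ, hJ0, hJL, hne⟩ := h
  have hJs := (isGeodesicOn_completeLift_iff hp).1 hJ.geodesic
  have hγs := (isGeodesicOn_iff.1 hγ).isSolutionOn_velocity (hS.isSemisprayOn hp) isOpen_Ioo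
  -- A zero vector has zero image under Dp, hence is not slashed.
  have hreg : ∀ t ∈ Ioo α β, velocity I γ t ≠ zeroVec I (γ t) := by
    intro t ht h0
    have := hγ.regular t ht
    rw [h0] at this
    exact this (map_zero (mfderiv I I₀ p (γ t)))
  exact ⟨velocity I γ 0, velocity I γ L, rfl, rfl, hreg 0 ⟨hα, hL.trans hβ⟩,
    hreg L ⟨hα.trans hL, hβ⟩, hasVanishingJacobi_vertLift (hS.isSemisprayOn hp) hp hL hα hβ
      hγs hJs hJ.proj hJ0 hJL hne⟩

theorem HasVanishingJacobi.of_completeLift {a b : TangentBundle I N}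
    (h : HasVanishingJacobi I.tangent I₀ (fun ξ : TangentBundle I N => p ξ.1)
      (completeLift I S) a b) (hS : IsSpray I I₀ p S) (hp : ContMDiff I I₀ ∞ p) :
    HasVanishingJacobi I I₀ p S a.1 b.1 := by
  obtain ⟨L, hL, α, hα, β, hβ, J, K, hJ, rfl, rfl, hK, hK0, hKL, t, ht, hKt⟩ := h
  have hSs := hS.isSemisprayOn hp
  have hKs := (isGeodesicOn_completeLift₂_iff hp).1 hK.geodesic
  have hJs := (isGeodesicOn_completeLift_iff hp).1 hJ
  have hγ := isGeodesicOn_iff.2 (hJs.foot hSs isOpen_Ioo)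
  have hU := hKs.comp_horProj hSs isOpen_Ioo
  have hproj : ∀ t ∈ Ioo α β, (K t).1.1 = (J t).1 := fun t ht => by rw [hK.proj t ht]
  -- Either the horizontal part of K is already a nontrivial Jacobi field, or K is vertical on [0,
  -- L] and its vertical part takes over.
  by_cases hne : ∃ t ∈ Icc 0 L, (horProj (K t)).2 ≠ 0
  · exact ⟨L, hL, α, hα, β, hβ, fun r => (J r).1, fun r => horProj (K r), hγ, rfl, rfl,
      ⟨(isGeodesicOn_completeLift_iff hp).2 hU, hproj⟩, congrArg Prod.fst hK0,
      congrArg Prod.fst hKL, hne⟩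
  · push Not at hne
    -- Vanishing on [0, L] is a neighbourhood condition at the midpoint, and it spreads to all of
    -- (α, β). This is needed because the vertical part must be a Jacobi field on the open interval.
    have hzero := hU.eq_zero hSs isOpen_Ioo isPreconnected_Ioo (t₀ := L / 2)
      ⟨by linarith, by linarith⟩
      (by filter_upwards [Icc_mem_nhds (half_pos hL) (half_lt_self hL)] with r hr using hne r hr)
    have hV := hKs.comp_vertProj hSs isOpen_Ioo hzero
    refine ⟨L, hL, α, hα, β, hβ, fun r => (J r).1, fun r => vertProj (K r), hγ, rfl, rfl,
      ⟨(isGeodesicOn_completeLift_iff hp).2 hV, hproj⟩, congrArg Prod.snd hK0,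
      congrArg Prod.snd hKL, t, ht, fun h0 => hKt (Prod.ext (hne t ht) h0)⟩

end Slashed

/-! ### Specialization to iterated tangent bundles -/

namespace SmoothMfd

variable (X : SmoothMfd) [X.I.Boundaryless]

instance boundaryless_iter : ∀ r, (X.iter r).I.Boundaryless
  | 0 => inferInstanceAs X.I.Boundaryless
  | r + 1 =>
    have := boundaryless_iter r
    inferInstanceAs (X.iter r).I.tangent.Boundaryless

theorem contMDiff_projection : ∀ r, ContMDiff (X.iter r).I X.I ∞ (X.proj r)
  | 0 => contMDiff_id
  | r + 1 => contMDiff_comp_proj (I := (X.iter r).I) (contMDiff_projection r)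

variable {X} {r : ℕ} {S : X.T (r + 1) → X.T (r + 2)}

theorem HasVanishingJacobi.zero {a b : X.T r} (h : X.HasVanishingJacobi r S a b)
    (hS : X.IsSpray r S) :
    X.HasVanishingJacobi (r + 1) (X.completeLift r S) (X.zero r a) (X.zero r b) :=
  _root_.HasVanishingJacobi.completeLift_zero h hS (X.contMDiff_projection r)

theorem HasVanishingJacobi.nonzero {a b : X.T r} (h : X.HasVanishingJacobi r S a b)
    (hS : X.IsSpray r S) :
    ∃ ξ η : X.T (r + 1), X.pr r ξ = a ∧ X.pr r η = b ∧ ξ ≠ X.zero r a ∧ η ≠ X.zero r b ∧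
      X.HasVanishingJacobi (r + 1) (X.completeLift r S) ξ η :=
  _root_.HasVanishingJacobi.completeLift_nonzero h hS (X.contMDiff_projection r)

theorem HasVanishingJacobi.pr {a b : X.T (r + 1)}
    (h : X.HasVanishingJacobi (r + 1) (X.completeLift r S) a b) (hS : X.IsSpray r S) :
    X.HasVanishingJacobi r S (X.pr r a) (X.pr r b) :=
  _root_.HasVanishingJacobi.of_completeLift h hS (X.contMDiff_projection r)

end SmoothMfd

end

theorem mainTheorem9 {n : ℕ} (hn : 1 ≤ n) {M : Type*} [TopologicalSpace M] [T2Space M]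
    [SecondCountableTopology M] [ChartedSpace (EuclideanSpace ℝ (Fin n)) M]
    [IsManifold (𝓡 n) ∞ M] (r : ℕ)
    (S : (SmoothMfd.of n M).T (r + 1) → (SmoothMfd.of n M).T (r + 2))
    (hS : (SmoothMfd.of n M).IsSpray r S) :
    let X := SmoothMfd.of n M
    -- the zero vectors over conjugate points are conjugate
    (∀ a b : X.T r, X.AreConjugate r S a b →
      X.AreConjugate (r + 1) (X.completeLift r S) (X.zero r a) (X.zero r b)) ∧
    -- over conjugate points there are nonzero conjugate points
    (∀ a b : X.T r, X.AreConjugate r S a b →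
      ∃ ξ η : X.T (r + 1), X.pr r ξ = a ∧ X.pr r η = b ∧ ξ ≠ X.zero r a ∧ η ≠ X.zero r b ∧
        X.AreConjugate (r + 1) (X.completeLift r S) ξ η) ∧
    -- conjugate points project to conjugate points, unless their projections coincide
    (∀ a b : X.T (r + 1), X.AreConjugate (r + 1) (X.completeLift r S) a b → X.pr r a ≠ X.pr r b →
      X.AreConjugate r S (X.pr r a) (X.pr r b)) ∧
    -- if the endpoints need not be distinct, then no exception is needed
    (∀ a b : X.T (r + 1), X.HasVanishingJacobi (r + 1) (X.completeLift r S) a b →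
      X.HasVanishingJacobi r S (X.pr r a) (X.pr r b)) ∧
    ((∃ a b : X.T r, X.HasVanishingJacobi r S a b) ↔
      ∃ a b : X.T (r + 1), X.HasVanishingJacobi (r + 1) (X.completeLift r S) a b) := by
  intro X
  refine ⟨fun a b h => ⟨fun hab => h.1 (congrArg (X.pr r) hab),
      SmoothMfd.HasVanishingJacobi.zero h.2 hS⟩, fun a b h => ?_,
    fun a b h hab => ⟨hab, SmoothMfd.HasVanishingJacobi.pr h.2 hS⟩, fun a b h => h.pr hS,
    fun ⟨a, b, h⟩ => ⟨_, _, h.zero hS⟩, fun ⟨a, b, h⟩ => ⟨_, _, h.pr hS⟩⟩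
  obtain ⟨ξ, η, rfl, rfl, hξ, hη, hj⟩ := SmoothMfd.HasVanishingJacobi.nonzero h.2 hS
  exact ⟨ξ, η, rfl, rfl, hξ, hη, fun hab => h.1 (congrArg (X.pr r) hab), hj⟩
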